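/- **Conventions.** Let $X$ be a normal toric variety with torus $T=(\mathbb C^*)^n$, character lattice $M=\mathbb Z^n$, lattice of one-parameter subgroups $N=\mathbb Z^n$, and set $R$ of torus-invariant prime divisors. Let $\mathrm{dv}\colon M\to\mathbb Z^R$, $\chi\mapsto(\mathrm{ord}_D\chi)_D=(\langle\chi,v_D\rangle)_D$, where $v_D\in N$ is the primitive generator of the ray of $D$; thus $A_{n-1}(X)=\mathrm{coker}(\mathrm{dv})$. For a regular function $W$ on $X$ with set of monomials $\Xi\subset M$ let $\mathrm{mon}\colon N\to\mathbb Z^\Xi$, $\nu\mapsto(\langle\xi,\nu\rangle)_\xi$. A basis of $M$ and an ordering of $R$ (resp. a basis of $N$ and an ordering of $\Xi$) give a matrix $M_{\mathrm{dv}}(X)$ (resp. $M_{\mathrm{mon}}(W)$), whose rows are indexed by $R$ (resp. $\Xi$). A *toric Landau–Ginzburg model* is a triple $(X,W,K)$ with $W$ regular on $X$ and $K\in A_{n-1}(X)\otimes\mathbb C/\mathbb Z$. *Linear data* are pairs $(A,K),(B,L)$ with $A\colon\mathbb Z^n\to\mathbb Z^r$, $B\colon\mathbb Z^n\to\mathbb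 Z^s$, $K\in\mathrm{coker}(A)\otimes\mathbb C/\mathbb Z$, $L\in\mathrm{coker}(B)\otimes\mathbb C/\mathbb Z$. For $c\in\mathbb R^r$ of class $\operatorname{Im}K\in\mathrm{coker}(A)\otimes\mathbb R$, let $P=\{\xi\in\mathbb R^n: A\xi+c\ge0\}$ and let $X(A,\operatorname{Im}K)$ be the toric variety of the inner normal fan of $P$ (independent of $c$). The data are *kopaseptic* if $P$ has non-empty interior, there is a surjection $\mathbb Z^r\to\mathbb Z^{R}$, with $R$ the set of invariant prime divisors of $X(A,\operatorname{Im}K)$, which sends standard generators to standard generators or to $0$ and carries $A$ to $\mathrm{dv}$, and all entries of $AB^T$ are $\ge0$. Kopaseptic data determine the model with variety $X(A,\operatorname{Im}K)$, superpotential $\sum_j e^{2\pi i\ell_j}\chi^{B_j}$ (where $B_j$ is the $j$-th row of $B$ and $\ell\in\mathbb C^s$ has class $L$; this is well defined up to $T$), and the image of $K$ in the Chow group under the surjection. If $(X,W,K)$ is the model of the data $(\mathrm{dv},K),(\mathrm{mon},L)$, its *dual* is the model of the exchanged data $(\mathrm{mon},L),(\mathrm{dv},K)$; and $(X,W,K)$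 is *self-dual* if, for some such $L$, it is isomorphic to its dual, where an isomorphism consists of a lattice isomorphism carrying fan to fan and a translation by the torus, matching the superpotentials and the Chow classes. Let $W_k=\mathrm{Tot}(\mathcal O(k)\oplus\mathcal O(-k-2))\to\mathbb P^1$, with torus coordinates $(t_1,t_2,t_3)$ acting on the base coordinate $z$ and on the two fibre coordinates. A section $w=(f_1,f_2)$ of the dual bundle $E=\mathcal O(-k)\oplus\mathcal O(k+2)$ defines the superpotential $W_w=t_2f_1(t_1)+t_3f_2(t_1)$ on $W_k$. For $d\in\mathbb Z$, a section $f$ of $\mathcal O(d)$ defines in the same way the superpotential $t_2f(t_1)$ on $\mathrm{Tot}(\mathcal O(-d))$. **Proposition.** Let $k\ge-1$ be an integer. 1. There are a section $w\in H^0(\mathbb P^1,E)$ and a class $K$ such that $(W_k,W_w,K)$ is a self-dual toric Landau–Ginzburg model if and only if $k=0$ or $k=-1$. 2. There is a section $w\in H^0(\mathbb P^1,E)$ such that $M_{\mathrm{mon}}(W_w)=M_{\mathrm{dv}}(W_k)$ for suitable bases and orderings if and only if $k=0$ or $k=-1$. 3. For $k=0$ the matrices split: if $D$ is a matrix $M_{\mathrm{dv}}$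 of $\mathrm{Tot}(\mathcal O(-2))$, then $\begin{pmatrix}D&0\\0&1\end{pmatrix}$ is a matrix $M_{\mathrm{dv}}$ of $W_0$; and if $w=(f_1,f_2)$ is a section of $\mathcal O\oplus\mathcal O(2)$ with $f_1\neq0$ and $F$ is a matrix $M_{\mathrm{mon}}$ of the superpotential on $\mathrm{Tot}(\mathcal O(-2))$ given by $f_2$, then $\begin{pmatrix}F&0\\0&1\end{pmatrix}$ is a matrix $M_{\mathrm{mon}}(W_w)$. 4. For $k=-1$ (the resolved conifold) and every section $w=(a_0+a_1z,\,b_0+b_1z)$ with $a_0,a_1,b_0,b_1$ all non-zero, $$\begin{pmatrix}1&0&0\\-1&1&1\\0&1&0\\0&0&1\end{pmatrix}$$ is, for suitable bases and orderings, both a matrix $M_{\mathrm{dv}}(W_{-1})$ and a matrix $M_{\mathrm{mon}}(W_w)$. -/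

import Mathlib

open scoped TensorProduct Matrix Polynomial LaurentPolynomial

/-! ## Toric varieties

The torus is `(ℂ^*)^n`.  Its characters form the lattice `M = ℤ^n` (the vector `m` is the monomial
`t₁^{m₁} ⋯ t_n^{m_n}`), its one-parameter subgroups form the dual lattice `N = ℤ^n`, and the pairing
of `M` with `N` is the dot product. -/

namespace ToricLG

/-- A lattice point, seen in `N_ℝ` (or `M_ℝ`). -/
def toReal {n : ℕ} (u : Fin n → ℤ) : Fin n → ℝ := fun i => (u i : ℝ)

/-- A normal toric variety with torus `(ℂ^*)^n`, given by its fan: a finite non-empty set of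
strongly convex rational polyhedral cones in `N_ℝ = ℝ^n`, closed under taking faces, in which any
two cones meet in a common face. -/
@[ext]
structure ToricVariety (n : ℕ) where
  cones : Set (PointedCone ℝ (Fin n → ℝ))
  finite : cones.Finite
  nonempty : cones.Nonempty
  rational : ∀ σ ∈ cones, ∃ G : Finset (Fin n → ℤ), σ = PointedCone.hull ℝ (toReal '' (G : Set _))
  salient : ∀ σ ∈ cones, ∀ x ∈ σ, -x ∈ σ → x = 0
  face_mem : ∀ σ ∈ cones, ∀ τ : PointedCone ℝ (Fin n → ℝ), τ.IsFaceOf σ → τ ∈ cones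
  inter_face : ∀ σ ∈ cones, ∀ τ ∈ cones, (σ ⊓ τ).IsFaceOf σ

/-- A primitive lattice vector (in particular it is non-zero). -/
def IsPrimitive {n : ℕ} (u : Fin n → ℤ) : Prop :=
  ∀ a : ℤ, (∀ i, a ∣ u i) → IsUnit a

/-- The set `R` of torus-invariant prime divisors of a toric variety: they correspond to the rays
of the fan, and each ray is recorded by its primitive generator `v_D ∈ N`. -/
def Divisors {n : ℕ} (cones : Set (PointedCone ℝ (Fin n → ℝ))) : Type :=
  {u : Fin n → ℤ // IsPrimitive u ∧ PointedCone.hull ℝ {toReal u} ∈ cones}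

/-- The map `dv : M → ℤ^R`, sending a character `χ` to its orders of vanishing
`ord_D χ = ⟨χ, v_D⟩` along the invariant prime divisors. -/
def dv {n : ℕ} (cones : Set (PointedCone ℝ (Fin n → ℝ))) :
    (Fin n → ℤ) →ₗ[ℤ] (Divisors cones → ℤ) where
  toFun m := fun D => m ⬝ᵥ D.1
  map_add' a b := by funext D; simp [add_dotProduct]
  map_smul' a b := by funext D; exact smul_dotProduct a b D.1

theorem divisor_eq_of_hull_eq {n : ℕ} {u v : Fin n → ℤ} (hu : IsPrimitive u) (hv : IsPrimitive v)
    (h : PointedCone.hull ℝ {toReal u} = PointedCone.hull ℝ {toReal v}) : u = v := by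
  have hu' : toReal u ∈ PointedCone.hull ℝ {toReal v} := h ▸ Submodule.mem_span_singleton_self _
  have hv' : toReal v ∈ PointedCone.hull ℝ {toReal u} := h ▸ Submodule.mem_span_singleton_self _
  obtain ⟨⟨a, ha⟩, hau⟩ := Submodule.mem_span_singleton.1 hu'
  obtain ⟨⟨b, hb⟩, hbv⟩ := Submodule.mem_span_singleton.1 hv'
  have hau : ∀ i, a * (v i : ℝ) = u i := fun i => congrFun hau i
  have hbv : ∀ i, b * (u i : ℝ) = v i := fun i => congrFun hbv i
  have hu0 : ∃ i, u i ≠ 0 := by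
    by_contra hc
    push Not at hc
    exact not_isUnit_zero (hu 0 (fun i => by simp [hc i]))
  obtain ⟨i, hi⟩ := hu0
  have hi' : (u i : ℝ) ≠ 0 := by exact_mod_cast hi
  have hvi : v i ≠ 0 := by
    intro h0
    have := hau i
    rw [h0] at this
    simp at this
    exact hi' this.symm
  -- cross-multiplication: `u i * v j = v i * u j`
  have hcross : ∀ j, u i * v j = v i * u j := fun j => by
    have : (u i : ℝ) * v j = v i * u j := by rw [← hau i, ← hau j]; ring
    exact_mod_cast this
  -- `v i ∣ u i`
  have key : ∀ {p q : Fin n → ℤ}, IsPrimitive p → (∀ j, p i * q j = q i * p j) → p i ∣ q i := by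
    intro p q hp hpq
    by_cases hp0 : p i = 0 ∧ q i = 0
    · simp [hp0.1, hp0.2]
    have hg : (Int.gcd (p i) (q i) : ℤ) ≠ 0 := by
      intro h0
      have h0 : Int.gcd (p i) (q i) = 0 := by exact_mod_cast h0
      exact hp0 (Int.gcd_eq_zero_iff.1 h0)
    obtain ⟨x, hx⟩ := Int.gcd_dvd_left (p i) (q i)
    obtain ⟨y, hy⟩ := Int.gcd_dvd_right (p i) (q i)
    have hco : IsCoprime x y := by
      refine Int.isCoprime_iff_gcd_eq_one.2 ?_
      have h1 := Int.gcd_mul_left (Int.gcd (p i) (q i) : ℤ) x y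
      rw [← hx, ← hy] at h1
      have hg' : Int.gcd (p i) (q i) ≠ 0 := by exact_mod_cast hg
      simp only [Int.natAbs_natCast] at h1
      exact (Nat.eq_of_mul_eq_mul_left (Nat.pos_of_ne_zero hg') (by rw [← h1, mul_one]))
    have hxu : IsUnit x := by
      refine hp x fun j => ?_
      have h2 : x * q j = y * p j := by
        have h3 := hpq j
        refine mul_left_cancel₀ hg ?_
        rw [← mul_assoc, ← mul_assoc, ← hx, ← hy]
        exact h3
      exact hco.dvd_of_dvd_mul_left ⟨q j, h2.symm⟩
    obtain ⟨x', rfl⟩ := hxu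
    rw [hx]
    exact (Units.mul_right_dvd).2 (Int.gcd_dvd_right _ _)
  have d1 : u i ∣ v i := key hu hcross
  have d2 : v i ∣ u i := key hv (fun j => (hcross j).symm)
  have ha0 : a ≠ 0 := by rintro rfl; exact hi' (by rw [← hau i, zero_mul])
  have hpos : 0 < a := lt_of_le_of_ne ha ha0.symm
  have heq : u i = v i := by
    rcases Int.associated_iff.1 (associated_of_dvd_dvd d1 d2) with h1 | h1
    · exact h1
    · exfalso
      have h2 := hau i
      rw [h1] at h2
      push_cast at h2
      have h3 : (v i : ℝ) ≠ 0 := by exact_mod_cast hvi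
      have h4 : (a + 1) * (v i : ℝ) = 0 := by linarith
      rcases mul_eq_zero.1 h4 with h5 | h5
      · linarith
      · exact h3 h5
  funext j
  have := hcross j
  rw [heq] at this
  exact (mul_left_cancel₀ hvi this).symm

/-- A toric variety has finitely many torus-invariant prime divisors. -/
instance divisorsFinite {n : ℕ} (X : ToricVariety n) : Finite (Divisors X.cones) := by
  have := X.finite.to_subtype
  refine Finite.of_injective
    (fun D : Divisors X.cones => (⟨_, D.2.2⟩ : X.cones)) fun D D' h => ?_
  exact Subtype.ext (divisor_eq_of_hull_eq D.2.1 D'.2.1 (congrArg Subtype.val h))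

noncomputable instance divisorsFintype {n : ℕ} (X : ToricVariety n) :
    Fintype (Divisors X.cones) := Fintype.ofFinite _

/-! ## Superpotentials -/

/-- Laurent polynomials in `t₁, …, t_n`: the algebraic functions on the torus. -/
abbrev Laurent (n : ℕ) : Type := AddMonoidAlgebra ℂ (Fin n → ℤ)

/-- The set `Ξ` of monomials (characters) occurring in `W`. -/
abbrev Monomials {n : ℕ} (W : Laurent n) : Type := {ξ : Fin n → ℤ // ξ ∈ W.coeff.support}

/-- The map `mon : N → ℤ^Ξ`, the infinitesimal torus action on the monomials of `W`: the
one-parameter subgroup `ν` acts on `ξ` with weight `⟨ξ, ν⟩`. -/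
def mon {n : ℕ} (W : Laurent n) : (Fin n → ℤ) →ₗ[ℤ] (Monomials W → ℤ) where
  toFun ν := fun ξ => ξ.1 ⬝ᵥ ν
  map_add' a b := by funext D; simp [dotProduct_add]
  map_smul' a b := by funext D; exact dotProduct_smul a D.1 b

/-- A function on the torus extends to a regular function on `X` iff it lies in
`ℂ[σ^∨ ∩ M]` for every cone `σ` of the fan. -/
def IsRegular {n : ℕ} (X : ToricVariety n) (W : Laurent n) : Prop :=
  ∀ ξ ∈ W.coeff.support, ∀ σ ∈ X.cones, ∀ x ∈ σ, 0 ≤ toReal ξ ⬝ᵥ x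

/-! ## Linear data -/

/-- The group `ℂ/ℤ`. -/
abbrev CModZ : Type := ℂ ⧸ AddSubgroup.zmultiples (1 : ℂ)

/-- The imaginary part `ℂ/ℤ → ℝ`. -/
def imCModZ : CModZ →+ ℝ :=
  QuotientAddGroup.lift _ Complex.imAddGroupHom (by
    intro x hx
    obtain ⟨a, rfl⟩ := AddSubgroup.mem_zmultiples_iff.1 hx
    simp)

section LinearData

variable {n : ℕ} {ι κ : Type}

/-- The cokernel of a homomorphism `A : ℤ^n → ℤ^ι`. For `A = dv(X)` this is the Chow group
`A_{n-1}(X)`. -/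
abbrev Coker (A : (Fin n → ℤ) →ₗ[ℤ] (ι → ℤ)) : Type := (ι → ℤ) ⧸ LinearMap.range A

/-- The rows of the matrix of `A`. -/
def row (A : (Fin n → ℤ) →ₗ[ℤ] (ι → ℤ)) (i : ι) : Fin n → ℤ := fun l => A (Pi.single l 1) i

open Classical in
/-- The image of `c ∈ G^ι = ℤ^ι ⊗ G` in `coker(A) ⊗ G`. -/
noncomputable def cokerClass [Fintype ι] (A : (Fin n → ℤ) →ₗ[ℤ] (ι → ℤ)) {G : Type}
    [AddCommGroup G] (c : ι → G) : Coker A ⊗[ℤ] G :=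
  ∑ i, (LinearMap.range A).mkQ (Pi.single i 1) ⊗ₜ[ℤ] c i

/-- The imaginary part `coker(A) ⊗ ℂ/ℤ → coker(A) ⊗ ℝ`. -/
noncomputable def imPart (A : (Fin n → ℤ) →ₗ[ℤ] (ι → ℤ)) (K : Coker A ⊗[ℤ] CModZ) :
    Coker A ⊗[ℤ] ℝ :=
  LinearMap.lTensor (Coker A) imCModZ.toIntLinearMap K

/-- The polyhedral set `P = {ξ ∈ M_ℝ | A ξ + c ≥ 0}`. -/
def polyhedron (A : (Fin n → ℤ) →ₗ[ℤ] (ι → ℤ)) (c : ι → ℝ) : Set (Fin n → ℝ) :=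
  {ξ | ∀ i, 0 ≤ toReal (row A i) ⬝ᵥ ξ + c i}

/-- The inner normal cone of `P` at `ξ`: the linear forms whose minimum on `P` is attained at `ξ`. -/
def normalCone (P : Set (Fin n → ℝ)) (ξ : Fin n → ℝ) : PointedCone ℝ (Fin n → ℝ) where
  carrier := {x | ∀ η ∈ P, ξ ⬝ᵥ x ≤ η ⬝ᵥ x}
  add_mem' := by
    intro a b ha hb η hη
    rw [dotProduct_add, dotProduct_add]
    exact add_le_add (ha η hη) (hb η hη)
  zero_mem' := by intro η _; simp
  smul_mem' := by
    rintro ⟨a, ha⟩ x hx η hη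
    change ξ ⬝ᵥ (a • x) ≤ η ⬝ᵥ (a • x)
    rw [dotProduct_smul, dotProduct_smul]
    exact mul_le_mul_of_nonneg_left (hx η hη) ha

/-- The inner normal fan of a polyhedral set. -/
def normalFan (P : Set (Fin n → ℝ)) : Set (PointedCone ℝ (Fin n → ℝ)) :=
  {σ | ∃ ξ ∈ P, σ = normalCone P ξ}

/-- The fan of the toric variety `X(A, κ)`, `κ ∈ coker(A) ⊗ ℝ`: the normal fan of
`{ξ | A ξ + c ≥ 0}` for the vectors `c ∈ ℝ^ι` of class `κ`.  (Different such `c` give translates of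
the same polyhedral set, hence the same fan.) -/
def fanOf [Fintype ι] (A : (Fin n → ℤ) →ₗ[ℤ] (ι → ℤ)) (k : Coker A ⊗[ℤ] ℝ) :
    Set (PointedCone ℝ (Fin n → ℝ)) :=
  {σ | ∃ c : ι → ℝ, cokerClass A c = k ∧ σ ∈ normalFan (polyhedron A c)}

/-- A surjection `ℤ^ι → ℤ^R` which sends each standard generator to a standard generator or to zero
and which carries `A` to `dv`, where `R` is the set of invariant divisors of the given fan. -/
def IsReduction (A : (Fin n → ℤ) →ₗ[ℤ] (ι → ℤ)) (cones : Set (PointedCone ℝ (Fin n → ℝ)))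
    (r : (ι → ℤ) →ₗ[ℤ] (Divisors cones → ℤ)) : Prop :=
  Function.Surjective r ∧
  (open Classical in
    ∀ i : ι, r (Pi.single i 1) = 0 ∨ ∃ D, r (Pi.single i 1) = Pi.single D 1) ∧
  r ∘ₗ A = dv cones

/-- Kopaseptic `ℝ`-linear data `(A, κ)`. -/
def IsKopaseptic [Fintype ι] (A : (Fin n → ℤ) →ₗ[ℤ] (ι → ℤ)) (k : Coker A ⊗[ℤ] ℝ) : Prop :=
  (∃ c : ι → ℝ, cokerClass A c = k ∧ (interior (polyhedron A c)).Nonempty) ∧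
  ∃ r, IsReduction A (fanOf A k) r

/-- Kopaseptic `ℂ/ℤ`-linear data `(A, K), (B, L)`; the second condition says that the entries of the
matrix `A ∘ Bᵀ` are non-negative. -/
def IsKopasepticPair [Fintype ι] (A : (Fin n → ℤ) →ₗ[ℤ] (ι → ℤ)) (K : Coker A ⊗[ℤ] CModZ)
    (B : (Fin n → ℤ) →ₗ[ℤ] (κ → ℤ)) : Prop :=
  IsKopaseptic A (imPart A K) ∧ ∀ i j, 0 ≤ row A i ⬝ᵥ row B j

/-- The map on cokernels (with `ℂ/ℤ` coefficients) induced by `r` with `r ∘ A = B`. -/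
noncomputable def cokerMap {A : (Fin n → ℤ) →ₗ[ℤ] (ι → ℤ)} {B : (Fin n → ℤ) →ₗ[ℤ] (κ → ℤ)}
    (r : (ι → ℤ) →ₗ[ℤ] (κ → ℤ)) (h : r ∘ₗ A = B) :
    Coker A ⊗[ℤ] CModZ →ₗ[ℤ] Coker B ⊗[ℤ] CModZ :=
  LinearMap.rTensor CModZ (Submodule.mapQ (LinearMap.range A) (LinearMap.range B) r (by
    rintro _ ⟨m, rfl⟩
    exact ⟨m, by rw [← h]; rfl⟩))

/-- `W` is the function `W(B, L) = ∑_j exp(2πi ℓ_j) χ^{B_j}` determined by `(B, L)`, where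
`ℓ ∈ ℂ^κ` is of class `L`. The function is well defined up to the action of the torus: the class of
its vector of coefficients in `(ℂ^*)^κ / T = coker(B) ⊗ ℂ/ℤ` is `L`. -/
def IsPotentialOf [Fintype κ] (B : (Fin n → ℤ) →ₗ[ℤ] (κ → ℤ)) (L : Coker B ⊗[ℤ] CModZ)
    (W : Laurent n) : Prop :=
  ∃ ℓ : κ → ℂ, cokerClass B (fun j => (ℓ j : CModZ)) = L ∧
    W = ∑ j, AddMonoidAlgebra.single (row B j) (Complex.exp (2 * Real.pi * Complex.I * ℓ j))

end LinearData

/-! ## Toric Landau–Ginzburg models and self-duality -/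

/-- A toric Landau–Ginzburg model `(X, W, K)`: a toric variety, a regular function and an element of
the Chow group with `ℂ/ℤ` coefficients. -/
structure Model (n : ℕ) where
  X : ToricVariety n
  W : Laurent n
  regular : IsRegular X W
  K : Coker (dv X.cones) ⊗[ℤ] CModZ

/-- `S` is the toric Landau–Ginzburg model given by the linear data `(A, K), (B, L)`, which are
required to be kopaseptic. -/
def IsModelOf {n : ℕ} {ι κ : Type} [Fintype ι] [Fintype κ]
    (A : (Fin n → ℤ) →ₗ[ℤ] (ι → ℤ)) (K : Coker A ⊗[ℤ] CModZ)
    (B : (Fin n → ℤ) →ₗ[ℤ] (κ → ℤ)) (L : Coker B ⊗[ℤ] CModZ) (S : Model n) : Prop :=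
  IsKopasepticPair A K B ∧
  S.X.cones = fanOf A (imPart A K) ∧
  IsPotentialOf B L S.W ∧
  ∃ (r : (ι → ℤ) →ₗ[ℤ] (Divisors S.X.cones → ℤ)) (h : IsReduction A S.X.cones r),
    S.K = cokerMap r h.2.2 K

/-- `S'` is dual to `S`: `S` is the model of its linear data `(dv, K), (mon, L)` and `S'` is the
model of the exchanged linear data `(mon, L), (dv, K)`. -/
def IsDual {n : ℕ} (S S' : Model n) : Prop :=
  ∃ L : Coker (mon S.W) ⊗[ℤ] CModZ,
    IsModelOf (dv S.X.cones) S.K (mon S.W) L S ∧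
    IsModelOf (mon S.W) L (dv S.X.cones) S.K S'

/-- The linear map of `ℝ^n` given by an integral invertible matrix. -/
noncomputable def realMap {n : ℕ} (g : GL (Fin n) ℤ) : (Fin n → ℝ) →ₗ[ℝ] (Fin n → ℝ) :=
  Matrix.mulVecLin ((g : Matrix (Fin n) (Fin n) ℤ).map (Int.cast : ℤ → ℝ))

/-- Isomorphism of toric Landau–Ginzburg models: an isomorphism of toric varieties, that is, an
isomorphism `g : N ≅ N'` of lattices carrying one fan to the other, followed by a translation by
`t ∈ T'`, which carries `W'` to `W` and identifies `K` with `K'`. -/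
def Isomorphic {n : ℕ} (S S' : Model n) : Prop :=
  ∃ (g : GL (Fin n) ℤ) (t : Fin n → ℂˣ),
    S'.X.cones = PointedCone.map (realMap g) '' S.X.cones ∧
    (∀ m : Fin n → ℤ, S.W.coeff (m ᵥ* (g : Matrix (Fin n) (Fin n) ℤ)) =
      ((∏ i, t i ^ m i : ℂˣ) : ℂ) * S'.W.coeff m) ∧
    ∃ (c : Divisors S.X.cones → CModZ) (c' : Divisors S'.X.cones → CModZ),
      cokerClass (dv S.X.cones) c = S.K ∧ cokerClass (dv S'.X.cones) c' = S'.K ∧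
      ∀ (D : Divisors S.X.cones) (D' : Divisors S'.X.cones),
        D'.1 = (g : Matrix (Fin n) (Fin n) ℤ) *ᵥ D.1 → c' D' = c D

/-- A toric Landau–Ginzburg model is self-dual if it is isomorphic to its dual. -/
def Model.IsSelfDual {n : ℕ} (S : Model n) : Prop :=
  ∃ S' : Model n, IsDual S S' ∧ Isomorphic S S'

/-- `D` is the matrix of `dv(X)` for some basis of `M` and some ordering of the invariant
divisors. -/
def IsDvMatrix {n : ℕ} {ι J : Type} (X : ToricVariety n) (D : Matrix ι J ℤ) : Prop :=
  ∃ (b : Module.Basis J ℤ (Fin n → ℤ)) (e : ι ≃ Divisors X.cones),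
    ∀ i j, D i j = dv X.cones (b j) (e i)

/-- `E` is the matrix of `mon` for some basis of `N` and some ordering of the monomials of `W`. -/
def IsMonMatrix {n : ℕ} {ι J : Type} (W : Laurent n) (E : Matrix ι J ℤ) : Prop :=
  ∃ (b : Module.Basis J ℤ (Fin n → ℤ)) (e : ι ≃ Monomials W),
    ∀ i j, E i j = mon W (b j) (e i)

/-! ## Split vector bundles over the projective line

`ℙ¹` has the charts with coordinates `z` and `z' = 1/z`. In `𝒪(d)` the fibre coordinates `y`, `y'`
over them are related by `y' = z^{-d} y`. -/

/-- The coordinates of the two standard charts of `Tot(𝒪(d₁) ⊕ … ⊕ 𝒪(d_c))` as characters of the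
torus `(ℂ^*)^{1+c}`, which acts on `(z, y₁, …, y_c)` coordinatewise. The first chart has the
coordinates `z, y₁, …, y_c`, the second one `z⁻¹, z^{-d₁} y₁, …, z^{-d_c} y_c`. -/
def chart {c : ℕ} (d : Fin c → ℤ) : Bool → Fin (c + 1) → (Fin (c + 1) → ℤ)
  | false => fun i => Pi.single i 1
  | true => Fin.cons (-Pi.single 0 1) (fun j => Pi.single j.succ 1 - d j • Pi.single 0 1)

/-- The cone of an affine chart `≅ ℂ^{1+c}`: the (real) one-parameter subgroups on which all the
coordinate characters are non-negative. -/
def chartCone {c : ℕ} (d : Fin c → ℤ) (a : Bool) : PointedCone ℝ (Fin (c + 1) → ℝ) where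
  carrier := {x | ∀ i, 0 ≤ toReal (chart d a i) ⬝ᵥ x}
  add_mem' := by
    intro x y hx hy i
    rw [dotProduct_add]
    exact add_nonneg (hx i) (hy i)
  zero_mem' := by intro i; simp
  smul_mem' := by
    rintro ⟨r, hr⟩ x hx i
    change 0 ≤ _ ⬝ᵥ (r • x)
    rw [dotProduct_smul]
    exact mul_nonneg hr (hx i)

/-- The primitive generators of the cone of a chart. -/
def chartGen {c : ℕ} (d : Fin c → ℤ) : Bool → Fin (c + 1) → (Fin (c + 1) → ℤ)
  | false => fun i => Pi.single i 1
  | true => Fin.cons (Fin.cons (-1) (fun j => -d j)) (fun j => Pi.single j.succ 1)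

theorem toReal_single {n : ℕ} (i : Fin n) : toReal (Pi.single i 1) = Pi.single i 1 := by
  funext j
  by_cases h : j = i
  · subst h; simp [toReal]
  · simp [toReal, h]

theorem chart_false_dot {c : ℕ} (d : Fin c → ℤ) (i : Fin (c + 1)) (x : Fin (c + 1) → ℝ) :
    toReal (chart d false i) ⬝ᵥ x = x i := by
  simp [chart, toReal_single]

theorem chart_true_zero_dot {c : ℕ} (d : Fin c → ℤ) (x : Fin (c + 1) → ℝ) :
    toReal (chart d true 0) ⬝ᵥ x = -x 0 := by
  have : toReal (chart d true 0) = -Pi.single 0 1 := by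
    rw [← toReal_single]; funext j; simp [chart, toReal]
  rw [this]; simp

theorem chart_true_succ_dot {c : ℕ} (d : Fin c → ℤ) (j : Fin c) (x : Fin (c + 1) → ℝ) :
    toReal (chart d true j.succ) ⬝ᵥ x = x j.succ - d j * x 0 := by
  have : toReal (chart d true j.succ) = Pi.single j.succ 1 - (d j : ℝ) • Pi.single 0 1 := by
    rw [← toReal_single, ← toReal_single]; funext l; simp [chart, toReal]
  rw [this]; simp [sub_dotProduct]

theorem mem_chartCone {c : ℕ} (d : Fin c → ℤ) (a : Bool) (x : Fin (c + 1) → ℝ) :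
    x ∈ chartCone d a ↔ ∀ i, 0 ≤ toReal (chart d a i) ⬝ᵥ x := Iff.rfl

theorem chart_expand {c : ℕ} (d : Fin c → ℤ) (a : Bool) (x : Fin (c + 1) → ℝ) :
    x = ∑ i, (toReal (chart d a i) ⬝ᵥ x) • toReal (chartGen d a i) := by
  cases a
  · simp only [chart_false_dot]
    funext j
    simp [chartGen, toReal_single, Finset.sum_apply, Pi.single_apply]
  · rw [Fin.sum_univ_succ]
    simp only [chart_true_zero_dot, chart_true_succ_dot]
    funext j
    refine Fin.cases ?_ (fun j => ?_) j
    · simp [chartGen, toReal, Finset.sum_apply]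
    · simp [chartGen, toReal, Finset.sum_apply, Pi.single_apply]
      ring

theorem chartGen_mem {c : ℕ} (d : Fin c → ℤ) (a : Bool) (i : Fin (c + 1)) :
    toReal (chartGen d a i) ∈ chartCone d a := by
  rw [mem_chartCone]
  intro l
  cases a
  · rw [chart_false_dot]
    simp only [chartGen, toReal, Pi.single_apply]
    split_ifs <;> simp
  · refine Fin.cases ?_ (fun l => ?_) l <;> refine Fin.cases ?_ (fun i => ?_) i
    · rw [chart_true_zero_dot]; simp [chartGen, toReal]
    · rw [chart_true_zero_dot]; simp [chartGen, toReal]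
    · rw [chart_true_succ_dot]; simp [chartGen, toReal]
    · rw [chart_true_succ_dot]
      have h0 : (0 : Fin (c + 1)) ≠ i.succ := (Fin.succ_ne_zero i).symm
      simp only [chartGen, toReal, Fin.cons_succ, Pi.single_apply, h0, if_false]
      split_ifs <;> simp

theorem face_eq_hull {c : ℕ} (d : Fin c → ℤ) (a : Bool) (F : PointedCone ℝ (Fin (c + 1) → ℝ))
    (hF : F.IsFaceOf (chartCone d a)) :
    F = PointedCone.hull ℝ
      ((fun i => toReal (chartGen d a i)) '' {i | toReal (chartGen d a i) ∈ F}) := by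
  apply le_antisymm
  · intro x hx
    have hx' := hF.le hx
    rw [chart_expand d a x] at hx ⊢
    refine Submodule.sum_mem _ fun i _ => ?_
    rcases (hx' i).lt_or_eq with h | h
    · have h2 := hF.mem_of_sum_smul_mem (fun i => chartGen_mem d a i) (fun i => hx' i) hx i h
      exact Submodule.smul_mem _ (⟨_, hx' i⟩ : {r : ℝ // 0 ≤ r})
        (Submodule.subset_span ⟨i, h2, rfl⟩)
    · rw [← h, zero_smul]; exact Submodule.zero_mem _
  · refine Submodule.span_le.2 ?_
    rintro _ ⟨i, hi, rfl⟩
    exact hi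

theorem chart_inter_face {c : ℕ} (d : Fin c → ℤ) (a b : Bool) :
    (chartCone d a ⊓ chartCone d b).IsFaceOf (chartCone d a) := by
  refine PointedCone.IsFaceOf.of_mem_of_add_mem_left inf_le_left ?_
  intro x y hx hy hxy
  refine ⟨hx, ?_⟩
  cases a <;> cases b
  · exact hx
  · have h1 := hxy.2 0
    rw [chart_true_zero_dot] at h1
    have hx0 := hx 0
    have hy0 := hy 0
    rw [chart_false_dot] at hx0 hy0
    have hz : x 0 = 0 := by
      simp only [Pi.add_apply] at h1
      linarith
    intro i
    refine Fin.cases ?_ (fun j => ?_) i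
    · rw [chart_true_zero_dot, hz]; simp
    · rw [chart_true_succ_dot, hz]
      have := hx j.succ
      rw [chart_false_dot] at this
      simpa using this
  · have h1 := hxy.2 0
    rw [chart_false_dot] at h1
    have hx0 := hx 0
    have hy0 := hy 0
    rw [chart_true_zero_dot] at hx0 hy0
    have hz : x 0 = 0 := by
      simp only [Pi.add_apply] at h1
      linarith
    intro i
    refine Fin.cases ?_ (fun j => ?_) i
    · rw [chart_false_dot, hz]
    · rw [chart_false_dot]
      have := hx j.succ
      rw [chart_true_succ_dot, hz] at this
      simpa using this
  · exact hx

/-- The total space of `𝒪(d₁) ⊕ … ⊕ 𝒪(d_c)` over `ℙ¹` as a toric variety: its fan consists of the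
faces of the cones of the two standard charts. -/
def totalSpace {c : ℕ} (d : Fin c → ℤ) : ToricVariety (c + 1) where
  cones := {τ | ∃ a, τ.IsFaceOf (chartCone d a)}
  finite := by
    refine (Set.finite_range fun p : Bool × Set (Fin (c + 1)) =>
      PointedCone.hull ℝ ((fun i => toReal (chartGen d p.1 i)) '' p.2)).subset ?_
    rintro τ ⟨a, h⟩
    exact ⟨(a, _), (face_eq_hull d a τ h).symm⟩
  nonempty := ⟨_, false, PointedCone.IsFaceOf.refl _⟩
  rational := by
    classical
    rintro σ ⟨a, h⟩
    refine ⟨(Finset.univ.filter fun i => toReal (chartGen d a i) ∈ σ).image (chartGen d a), ?_⟩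
    conv_lhs => rw [face_eq_hull d a σ h]
    congr 1
    rw [Finset.coe_image, Set.image_image]
    simp
  salient := by
    rintro σ ⟨a, h⟩ x hx hx'
    have h1 := h.le hx
    have h2 := h.le hx'
    rw [chart_expand d a x]
    refine Finset.sum_eq_zero fun i _ => ?_
    have h3 := h1 i
    have h4 := h2 i
    rw [dotProduct_neg] at h4
    rw [show toReal (chart d a i) ⬝ᵥ x = 0 by linarith, zero_smul]
  face_mem := by
    rintro σ ⟨a, h⟩ τ hτ
    exact ⟨a, hτ.trans h⟩
  inter_face := by
    rintro σ ⟨a, h⟩ τ ⟨b, h'⟩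
    have e : σ ⊓ (chartCone d a ⊓ chartCone d b) = σ ⊓ chartCone d b := by
      rw [← inf_assoc, inf_eq_left.2 h.le]
    have f1 : (σ ⊓ τ).IsFaceOf (σ ⊓ chartCone d b) := (PointedCone.IsFaceOf.refl σ).inf h'
    have f2 : (σ ⊓ chartCone d b).IsFaceOf (σ ⊓ chartCone d a) := by
      rw [← e]; exact (PointedCone.IsFaceOf.refl σ).inf (chart_inter_face d a b)
    rw [inf_eq_left.2 h.le] at f2
    exact f1.trans f2

/-- `f(z)` is (the expression in the chart `z` of) a global section of `𝒪_{ℙ¹}(e)`: over the chart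
`z' = 1/z` it is given by a polynomial `g(z')`, with `f(z) = z^e g(1/z)`. -/
def IsSection (e : ℤ) (f : ℂ[X]) : Prop :=
  ∃ g : ℂ[X], Polynomial.toLaurent f =
    LaurentPolynomial.T e * LaurentPolynomial.invert (Polynomial.toLaurent g)

/-- The function `W(z, y₁, …, y_c) = ∑_j y_j f_j(z)` on the total space of `E^∨` defined by a section
`(f₁, …, f_c)` of `E`, as a Laurent polynomial in the torus coordinates. -/
noncomputable def superpotential {c : ℕ} (f : Fin c → ℂ[X]) : Laurent (c + 1) :=
  ∑ j, (f j).sum fun i a => AddMonoidAlgebra.single (Fin.cons (i : ℤ) (Pi.single j 1)) a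

/-- The Calabi–Yau threefold `W_k = Tot(𝒪(k) ⊕ 𝒪(-k-2))` over `ℙ¹`. -/
def Wk (k : ℤ) : ToricVariety 3 := totalSpace ![k, -k - 2]

end ToricLG

namespace ToricLG

/-! ## Rays of the total spaces of split bundles -/

/-! Obstruction for `k ≥ 1`: the bundle `𝒪(-k)` has no non-zero section, so no monomial of the
superpotential involves `t₂`, and `mon` kills the second standard one-parameter subgroup. On the
other hand `dv` of `W_k` is injective, because the rays span `N`. Self-duality carries this
injectivity over to `mon`: the fan of the dual is a lattice image of the fan of `W_k`, and the `dv`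
of the dual factors through `mon` by the definition of linear data
(`Model.IsSelfDual.mon_injective`). A common matrix carries it over as well, since injectivity is
independence of the columns (`mon_injective_of_matrix`).

Construction for `k = 0, -1`: some symmetric `g` in `GL₃(ℤ)` takes the four ray generators to the
four monomials of a generic superpotential. As `⟨g v, ν⟩ = ⟨v, g ν⟩`, the map `mon` is `dv ∘ g` up
to the order of the rows. This gives a common matrix (`isMonMatrix_of_symm`). It also shows that
exchanging the linear data only moves the model by `g`, provided that the coefficients of the
superpotential are `exp(2πi k_D)` for the same vector `k` that represents the class `K`
(`exists_isSelfDual`).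

What is left is to find `k` whose imaginary part recovers the fan. The value `i` on the fibre over
`z = ∞` and `0` elsewhere works whenever all degrees are non-positive
(`normalFan_bundlePolyhedron`), and the degrees here are `(0, -2)` and `(-1, -1)`.

For `k = 0` the trivial summand splits off one ray, `e₂`, and one monomial, `t₂`; this accounts for
the identity block. -/

theorem chart_dot_chartGen {c : ℕ} (d : Fin c → ℤ) (a : Bool) (i j : Fin (c + 1)) :
    toReal (chart d a i) ⬝ᵥ toReal (chartGen d a j) = if i = j then 1 else 0 := by
  cases a
  · rw [chart_false_dot]
    simp [chartGen, toReal, Pi.single_apply]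
  · refine Fin.cases ?_ (fun i => ?_) i <;> refine Fin.cases ?_ (fun j => ?_) j
    · rw [chart_true_zero_dot]; simp [chartGen, toReal]
    · rw [chart_true_zero_dot]; simp [chartGen, toReal, (Fin.succ_ne_zero j).symm]
    · rw [chart_true_succ_dot]; simp [chartGen, toReal]
    · rw [chart_true_succ_dot]
      simp [chartGen, toReal, Pi.single_apply, (Fin.succ_ne_zero j).symm]

/-- The face of a chart cone cut out by the vanishing of some coordinate characters. -/
def chartFace {c : ℕ} (d : Fin c → ℤ) (a : Bool) (J : Set (Fin (c + 1))) :
    PointedCone ℝ (Fin (c + 1) → ℝ) where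
  carrier := {x | x ∈ chartCone d a ∧ ∀ i ∈ J, toReal (chart d a i) ⬝ᵥ x = 0}
  add_mem' := by
    rintro x y ⟨hx, hx'⟩ ⟨hy, hy'⟩
    exact ⟨add_mem hx hy, fun i hi => by rw [dotProduct_add, hx' i hi, hy' i hi, add_zero]⟩
  zero_mem' := ⟨zero_mem _, by simp⟩
  smul_mem' := by
    rintro r x ⟨hx, hx'⟩
    refine ⟨Submodule.smul_mem _ r hx, fun i hi => ?_⟩
    change _ ⬝ᵥ ((r : ℝ) • x) = 0
    rw [dotProduct_smul, hx' i hi, smul_zero]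

theorem mem_chartFace {c : ℕ} {d : Fin c → ℤ} {a : Bool} {J : Set (Fin (c + 1))}
    {x : Fin (c + 1) → ℝ} :
    x ∈ chartFace d a J ↔ x ∈ chartCone d a ∧ ∀ i ∈ J, toReal (chart d a i) ⬝ᵥ x = 0 := Iff.rfl

theorem chartFace_isFaceOf {c : ℕ} (d : Fin c → ℤ) (a : Bool) (J : Set (Fin (c + 1))) :
    (chartFace d a J).IsFaceOf (chartCone d a) := by
  refine PointedCone.IsFaceOf.of_mem_of_add_mem_left (fun x hx => hx.1) ?_
  intro x y hx hy hxy
  refine ⟨hx, fun i hi => ?_⟩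
  have h := hxy.2 i hi
  rw [dotProduct_add] at h
  linarith [hx i, hy i]

theorem chartGen_mem_chartFace {c : ℕ} {d : Fin c → ℤ} {a : Bool} {J : Set (Fin (c + 1))}
    {i : Fin (c + 1)} : toReal (chartGen d a i) ∈ chartFace d a J ↔ i ∉ J := by
  rw [mem_chartFace]
  refine ⟨fun h hi => ?_, fun hi => ⟨chartGen_mem d a i, fun j hj => ?_⟩⟩
  · have := h.2 i hi
    rw [chart_dot_chartGen] at this
    simp at this
  · rw [chart_dot_chartGen, if_neg]
    rintro rfl
    exact hi hj

/-- The cone is simplicial, so a face is the hull of the generators it contains, and both sides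
contain the same ones. -/
theorem eq_chartFace {c : ℕ} (d : Fin c → ℤ) (a : Bool) (F : PointedCone ℝ (Fin (c + 1) → ℝ))
    (hF : F.IsFaceOf (chartCone d a)) :
    F = chartFace d a {i | toReal (chartGen d a i) ∉ F} := by
  rw [face_eq_hull d a _ (chartFace_isFaceOf d a {i | toReal (chartGen d a i) ∉ F})]
  conv_lhs => rw [face_eq_hull d a F hF]
  congr 2
  ext i
  simp only [Set.mem_ofPred_eq, chartGen_mem_chartFace, not_not]

theorem isPrimitive_chartGen {c : ℕ} (d : Fin c → ℤ) (a : Bool) (i : Fin (c + 1)) :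
    IsPrimitive (chartGen d a i) := by
  intro x hx
  cases a
  · have := hx i
    simpa [chartGen, isUnit_iff_dvd_one] using this
  · have := hx i
    revert this
    refine Fin.cases ?_ (fun j => ?_) i
    · simp [chartGen, isUnit_iff_dvd_one]
    · simp [chartGen, isUnit_iff_dvd_one]

theorem hull_chartGen {c : ℕ} (d : Fin c → ℤ) (a : Bool) (i : Fin (c + 1)) :
    PointedCone.hull ℝ {toReal (chartGen d a i)} = chartFace d a {j | j ≠ i} := by
  rw [face_eq_hull d a _ (chartFace_isFaceOf d a {j | j ≠ i})]
  congr 1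
  simp only [chartGen_mem_chartFace]
  simp

/-- The torus-invariant prime divisors of a total space correspond to the generators of the chart
cones. -/
theorem isDivisor_totalSpace_iff {c : ℕ} (d : Fin c → ℤ) (u : Fin (c + 1) → ℤ) :
    (IsPrimitive u ∧ PointedCone.hull ℝ {toReal u} ∈ (totalSpace d).cones) ↔
      ∃ a i, u = chartGen d a i := by
  constructor
  · rintro ⟨hu, a, hF⟩
    have hu0 : ∃ l, u l ≠ 0 := by
      by_contra hc
      push Not at hc
      exact not_isUnit_zero (hu 0 (fun i => by simp [hc i]))
    obtain ⟨l, hl⟩ := hu0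
    have hmem : toReal u ∈ PointedCone.hull ℝ {toReal u} := Submodule.mem_span_singleton_self _
    -- The ray is the hull of the generators it contains; with none of them it would be zero.
    have hex : ∃ i, toReal (chartGen d a i) ∈ PointedCone.hull ℝ {toReal u} := by
      by_contra hc
      push Not at hc
      rw [face_eq_hull d a _ hF] at hmem
      have : {i | toReal (chartGen d a i) ∈ PointedCone.hull ℝ {toReal u}} = ∅ := by
        ext i; simpa using hc i
      rw [this] at hmem
      simp only [Set.image_empty, Submodule.span_empty, Submodule.mem_bot] at hmem
      have := congrFun hmem l
      simp [toReal] at this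
      exact hl this
    obtain ⟨i, hi⟩ := hex
    refine ⟨a, i, ?_⟩
    obtain ⟨r, hr⟩ := Submodule.mem_span_singleton.1 hi
    have hr0 : r ≠ 0 := by
      rintro rfl
      have := chart_dot_chartGen d a i i
      rw [← hr] at this
      simp at this
    refine divisor_eq_of_hull_eq hu (isPrimitive_chartGen d a i) ?_
    apply le_antisymm
    · refine Submodule.span_le.2 ?_
      rintro _ rfl
      refine Submodule.mem_span_singleton.2 ⟨r⁻¹, ?_⟩
      rw [← hr, smul_smul, inv_mul_cancel₀ hr0, one_smul]
    · refine Submodule.span_le.2 ?_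
      rintro _ rfl
      exact hi
  · rintro ⟨a, i, rfl⟩
    exact ⟨isPrimitive_chartGen d a i, a, hull_chartGen d a i ▸ chartFace_isFaceOf d a _⟩

/-! ## Superpotentials and sections -/

theorem cons_single_injective {c : ℕ} {i i' : ℕ} {j j' : Fin c}
    (h : (Fin.cons (i : ℤ) (Pi.single j 1) : Fin (c + 1) → ℤ) =
      Fin.cons (i' : ℤ) (Pi.single j' 1)) : i = i' ∧ j = j' := by
  refine ⟨by simpa using congrFun h 0, ?_⟩
  have := congrFun h j.succ
  by_contra hne
  simp [hne] at this

/-- Distinct pairs `(i, j)` give distinct monomials `z^i y_j`, so nothing cancels or merges in the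
sum. -/
theorem coeff_superpotential {c : ℕ} (f : Fin c → ℂ[X]) (j : Fin c) (i : ℕ) :
    (superpotential f).coeff (Fin.cons (i : ℤ) (Pi.single j 1)) = (f j).coeff i := by
  classical
  have key : ∀ j' : Fin c, ((f j').sum fun i a => (AddMonoidAlgebra.single
      (Fin.cons (i : ℤ) (Pi.single j' 1)) a : Laurent (c + 1))).coeff
        (Fin.cons (i : ℤ) (Pi.single j 1)) = if j' = j then (f j).coeff i else 0 := by
    intro j'
    rw [Polynomial.sum_def, AddMonoidAlgebra.coeff_sum, Finsupp.finsetSum_apply]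
    simp only [AddMonoidAlgebra.coeff_single, Finsupp.single_apply]
    split_ifs with h
    · subst h
      rw [Finset.sum_eq_single i]
      · simp
      · intro b _ hb
        rw [if_neg]
        exact fun h => hb (cons_single_injective h).1
      · intro h
        simpa using h
    · refine Finset.sum_eq_zero fun b _ => ?_
      rw [if_neg]
      exact fun h' => h (cons_single_injective h').2
  rw [superpotential, AddMonoidAlgebra.coeff_sum, Finsupp.finsetSum_apply]
  simp [key]

theorem mem_support_superpotential {c : ℕ} (f : Fin c → ℂ[X]) (m : Fin (c + 1) → ℤ) :
    m ∈ (superpotential f).coeff.support ↔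
      ∃ (j : Fin c) (i : ℕ), (f j).coeff i ≠ 0 ∧ m = Fin.cons (i : ℤ) (Pi.single j 1) := by
  classical
  constructor
  · intro h
    by_contra hc
    push Not at hc
    refine Finsupp.mem_support_iff.1 h ?_
    rw [superpotential, AddMonoidAlgebra.coeff_sum, Finsupp.finsetSum_apply]
    refine Finset.sum_eq_zero fun j _ => ?_
    rw [Polynomial.sum_def, AddMonoidAlgebra.coeff_sum, Finsupp.finsetSum_apply]
    refine Finset.sum_eq_zero fun i hi => ?_
    rw [AddMonoidAlgebra.coeff_single, Finsupp.single_apply, if_neg]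
    exact fun h => hc j i (Polynomial.mem_support_iff.1 hi) h.symm
  · rintro ⟨j, i, h, rfl⟩
    rw [Finsupp.mem_support_iff, coeff_superpotential]
    exact h

theorem coeff_toLaurent_natCast (f : ℂ[X]) (i : ℕ) :
    (Polynomial.toLaurent f).coeff (i : ℤ) = f.coeff i := by
  rw [LaurentPolynomial.coeff_toLaurent]
  exact Finsupp.mapDomain_apply (Nat.castEmbedding (R := ℤ)).injective _ _

theorem coeff_toLaurent_of_neg (f : ℂ[X]) {l : ℤ} (hl : l < 0) :
    (Polynomial.toLaurent f).coeff l = 0 := by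
  rw [← Finsupp.notMem_support_iff, LaurentPolynomial.support_coeff_toLaurent]
  intro h
  obtain ⟨j, _, hj⟩ := Finset.mem_map.1 h
  have : (j : ℤ) = l := hj
  omega

/-- In `z^e g(1/z)` no exponent exceeds `e`. For `e < 0` this leaves only `f = 0`, the source of the
obstruction. -/
theorem IsSection.coeff_eq_zero {e : ℤ} {f : ℂ[X]} (h : IsSection e f) {i : ℕ} (hi : e < i) :
    f.coeff i = 0 := by
  obtain ⟨g, hg⟩ := h
  rw [← coeff_toLaurent_natCast, hg, LaurentPolynomial.T,
    show (i : ℤ) = e + (i - e) by ring, AddMonoidAlgebra.coeff_single_mul_add,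
    LaurentPolynomial.invert_apply, coeff_toLaurent_of_neg _ (by omega), mul_zero]

/-! ## Classes in cokernels and normal fans -/

section Cokernels

variable {n : ℕ} {ι κ : Type}

theorem apply_eq_row_dotProduct (A : (Fin n → ℤ) →ₗ[ℤ] (ι → ℤ)) (m : Fin n → ℤ) (i : ι) :
    A m i = row A i ⬝ᵥ m := by
  conv_lhs => rw [pi_eq_sum_univ' m]
  rw [map_sum, Finset.sum_apply, dotProduct]
  refine Finset.sum_congr rfl fun l _ => ?_
  rw [map_smul, row, Pi.smul_apply, smul_eq_mul, mul_comm]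

/-- The real extension of `A`. -/
def realExtension (A : (Fin n → ℤ) →ₗ[ℤ] (ι → ℤ)) : (Fin n → ℝ) →ₗ[ℝ] (ι → ℝ) :=
  Matrix.mulVecLin (Matrix.of fun i => toReal (row A i))

theorem realExtension_apply (A : (Fin n → ℤ) →ₗ[ℤ] (ι → ℤ)) (ξ : Fin n → ℝ) (i : ι) :
    realExtension A ξ i = toReal (row A i) ⬝ᵥ ξ := rfl

/-- The canonical map from `coker(A) ⊗ ℝ` to the real cokernel of `A`. -/
noncomputable def realCoker (A : (Fin n → ℤ) →ₗ[ℤ] (ι → ℤ)) :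
    Coker A ⊗[ℤ] ℝ →ₗ[ℤ] ((ι → ℝ) ⧸ LinearMap.range (realExtension A)) :=
  TensorProduct.lift (Submodule.liftQ (LinearMap.range A)
    (LinearMap.mk₂ ℤ (fun (f : ι → ℤ) (r : ℝ) =>
      (LinearMap.range (realExtension A)).mkQ (fun i => (f i : ℝ) * r))
      (by intro f f' r; rw [← map_add]; congr 1; ext i; simp [add_mul])
      (by intro a f r; rw [← map_zsmul]; congr 1; ext i; simp [mul_assoc])
      (by intro f r r'; rw [← map_add]; congr 1; ext i; simp [mul_add])
      (by intro a f r; rw [← map_zsmul]; congr 1; ext i; simp [mul_left_comm]))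
    (by
      rintro _ ⟨m, rfl⟩
      ext r
      simp only [LinearMap.mk₂_apply, LinearMap.zero_apply, Submodule.mkQ_apply,
        Submodule.Quotient.mk_eq_zero]
      -- The vector `r · A m` is the image of `r m` under the real extension.
      refine ⟨r • toReal m, ?_⟩
      ext i
      rw [realExtension_apply, dotProduct_smul, apply_eq_row_dotProduct, smul_eq_mul, mul_comm]
      congr 1
      simp [dotProduct, toReal]))

theorem realCoker_mkQ_tmul (A : (Fin n → ℤ) →ₗ[ℤ] (ι → ℤ)) (f : ι → ℤ) (r : ℝ) :
    realCoker A ((LinearMap.range A).mkQ f ⊗ₜ r) =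
      (LinearMap.range (realExtension A)).mkQ (fun i => (f i : ℝ) * r) := rfl

theorem realCoker_cokerClass [Fintype ι] (A : (Fin n → ℤ) →ₗ[ℤ] (ι → ℤ)) (c : ι → ℝ) :
    realCoker A (cokerClass A c) = (LinearMap.range (realExtension A)).mkQ c := by
  classical
  rw [cokerClass, map_sum]
  simp only [realCoker_mkQ_tmul]
  rw [← map_sum]
  congr 1
  ext i
  simp [Pi.single_apply]

/-- Applying `realCoker` suffices; its injectivity is not needed. -/
theorem exists_translation_of_cokerClass_eq [Fintype ι] {A : (Fin n → ℤ) →ₗ[ℤ] (ι → ℤ)}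
    {c c' : ι → ℝ} (h : cokerClass A c = cokerClass A c') :
    ∃ ξ : Fin n → ℝ, ∀ i, c i = c' i + toReal (row A i) ⬝ᵥ ξ := by
  have h1 := congrArg (realCoker A) h
  rw [realCoker_cokerClass, realCoker_cokerClass, Submodule.mkQ_apply, Submodule.mkQ_apply,
    Submodule.Quotient.eq] at h1
  obtain ⟨ξ, hξ⟩ := h1
  refine ⟨ξ, fun i => ?_⟩
  have := congrFun hξ i
  rw [realExtension_apply, Pi.sub_apply] at this
  linarith

/-- A translation moves the minimisers along and adds a constant to each linear form. -/
theorem normalFan_subset_of_translation {P P' : Set (Fin n → ℝ)} (ξ₀ : Fin n → ℝ)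
    (h : ∀ η, η ∈ P' ↔ η + ξ₀ ∈ P) : normalFan P' ⊆ normalFan P := by
  rintro _ ⟨ξ, hξ, rfl⟩
  refine ⟨ξ + ξ₀, (h ξ).1 hξ, ?_⟩
  ext x
  change (∀ η ∈ P', ξ ⬝ᵥ x ≤ η ⬝ᵥ x) ↔ ∀ η ∈ P, (ξ + ξ₀) ⬝ᵥ x ≤ η ⬝ᵥ x
  constructor
  · intro hx η hη
    have := hx (η - ξ₀) ((h _).2 (by simpa using hη))
    rw [sub_dotProduct] at this
    rw [add_dotProduct]
    linarith
  · intro hx η hη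
    have := hx (η + ξ₀) ((h _).1 hη)
    rw [add_dotProduct, add_dotProduct] at this
    linarith

/-- All representatives of a class give translates of one polyhedron, so the fan can be computed
from any single `c`. -/
theorem fanOf_cokerClass [Fintype ι] (A : (Fin n → ℤ) →ₗ[ℤ] (ι → ℤ)) (c : ι → ℝ) :
    fanOf A (cokerClass A c) = normalFan (polyhedron A c) := by
  ext σ
  constructor
  · rintro ⟨c', h, hσ⟩
    obtain ⟨ξ, hξ⟩ := exists_translation_of_cokerClass_eq h
    refine normalFan_subset_of_translation ξ (fun η => ?_) hσ
    refine forall_congr' fun i => ?_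
    rw [hξ i, dotProduct_add]
    ring_nf
  · exact fun h => ⟨c, rfl, h⟩

theorem imPart_cokerClass [Fintype ι] (A : (Fin n → ℤ) →ₗ[ℤ] (ι → ℤ)) (c : ι → CModZ) :
    imPart A (cokerClass A c) = cokerClass A (fun i => imCModZ (c i)) := by
  simp [imPart, cokerClass, map_sum]

theorem cokerMap_mkQ_tmul {A : (Fin n → ℤ) →ₗ[ℤ] (ι → ℤ)} {B : (Fin n → ℤ) →ₗ[ℤ] (κ → ℤ)}
    (r : (ι → ℤ) →ₗ[ℤ] (κ → ℤ)) (h : r ∘ₗ A = B) (f : ι → ℤ) (x : CModZ) :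
    cokerMap r h ((LinearMap.range A).mkQ f ⊗ₜ x) = (LinearMap.range B).mkQ (r f) ⊗ₜ x := rfl

/-- A bijection of the index sets that carries `A` to `B` carries classes to classes. -/
theorem cokerMap_cokerClass [Fintype ι] [Fintype κ] {A : (Fin n → ℤ) →ₗ[ℤ] (ι → ℤ)}
    {B : (Fin n → ℤ) →ₗ[ℤ] (κ → ℤ)} (e : ι ≃ κ) (r : (ι → ℤ) →ₗ[ℤ] (κ → ℤ)) (h : r ∘ₗ A = B)
    (hr : ∀ f k, r f k = f (e.symm k)) (c : ι → CModZ) :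
    cokerMap r h (cokerClass A c) = cokerClass B (fun k => c (e.symm k)) := by
  classical
  rw [cokerClass, cokerClass, map_sum, ← e.sum_comp]
  refine Finset.sum_congr rfl fun i _ => ?_
  rw [cokerMap_mkQ_tmul, Equiv.symm_apply_apply]
  congr 2
  ext k
  rw [hr]
  simp [Pi.single_apply, Equiv.symm_apply_eq]

end Cokernels

/-! ## Change of lattice coordinates -/

section LatticeCoordinates

variable {n : ℕ}

theorem toReal_mulVec (g : GL (Fin n) ℤ) (u : Fin n → ℤ) :
    toReal ((g : Matrix (Fin n) (Fin n) ℤ) *ᵥ u) = realMap g (toReal u) := by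
  ext i
  simp [toReal, realMap, Matrix.mulVec, dotProduct]

theorem realMap_comp (g h : GL (Fin n) ℤ) (x : Fin n → ℝ) :
    realMap g (realMap h x) = realMap (g * h) x := by
  simp only [realMap, Matrix.mulVecLin_apply, Matrix.mulVec_mulVec]
  rw [Units.val_mul, Matrix.map_mul_intCast]

theorem realMap_one (x : Fin n → ℝ) : realMap (1 : GL (Fin n) ℤ) x = x := by
  simp [realMap, Matrix.map_one]

/-- The action of a lattice automorphism on `N_ℝ`. -/
noncomputable def realEquiv (g : GL (Fin n) ℤ) : (Fin n → ℝ) ≃ₗ[ℝ] (Fin n → ℝ) where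
  __ := realMap g
  invFun := realMap g⁻¹
  left_inv x := by
    change realMap g⁻¹ (realMap g x) = x
    rw [realMap_comp, inv_mul_cancel, realMap_one]
  right_inv x := by
    change realMap g (realMap g⁻¹ x) = x
    rw [realMap_comp, mul_inv_cancel, realMap_one]

theorem realMap_injective (g : GL (Fin n) ℤ) : Function.Injective (realMap g) :=
  (realEquiv g).injective

theorem map_hull_realMap (g : GL (Fin n) ℤ) (G : Set (Fin n → ℝ)) :
    PointedCone.map (realMap g) (PointedCone.hull ℝ G) = PointedCone.hull ℝ (realMap g '' G) :=
  Submodule.map_span _ _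

theorem map_realMap_inf (g : GL (Fin n) ℤ) (σ τ : PointedCone ℝ (Fin n → ℝ)) :
    PointedCone.map (realMap g) σ ⊓ PointedCone.map (realMap g) τ =
      PointedCone.map (realMap g) (σ ⊓ τ) :=
  (Submodule.map_inf ((realMap g).restrictScalars {r : ℝ // 0 ≤ r}) (realMap_injective g)).symm

theorem map_realMap_comp (g h : GL (Fin n) ℤ) (σ : PointedCone ℝ (Fin n → ℝ)) :
    PointedCone.map (realMap g) (PointedCone.map (realMap h) σ) =
      PointedCone.map (realMap (g * h)) σ := by
  ext x
  simp [PointedCone.mem_map, realMap_comp]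

theorem map_realMap_one (σ : PointedCone ℝ (Fin n → ℝ)) :
    PointedCone.map (realMap 1) σ = σ := by
  ext x
  simp [PointedCone.mem_map, realMap_one]

/-- The image of a toric variety under a change of lattice coordinates. -/
noncomputable def ToricVariety.map (g : GL (Fin n) ℤ) (X : ToricVariety n) : ToricVariety n where
  cones := PointedCone.map (realMap g) '' X.cones
  finite := X.finite.image _
  nonempty := X.nonempty.image _
  rational := by
    classical
    rintro _ ⟨σ, hσ, rfl⟩
    obtain ⟨G, rfl⟩ := X.rational σ hσ
    refine ⟨G.image fun u => (g : Matrix (Fin n) (Fin n) ℤ) *ᵥ u, ?_⟩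
    rw [map_hull_realMap, Finset.coe_image, Set.image_image, Set.image_image]
    simp only [toReal_mulVec]
  salient := by
    rintro _ ⟨σ, hσ, rfl⟩ x hx hx'
    obtain ⟨y, hy, rfl⟩ := PointedCone.mem_map.1 hx
    obtain ⟨z, hz, hz'⟩ := PointedCone.mem_map.1 hx'
    rw [← map_neg] at hz'
    rw [realMap_injective g hz'] at hz
    rw [X.salient σ hσ y hy hz, map_zero]
  face_mem := by
    rintro _ ⟨σ, hσ, rfl⟩ τ hτ
    have h := hτ.map (realMap g⁻¹) (realMap_injective g⁻¹)
    rw [map_realMap_comp, inv_mul_cancel, map_realMap_one] at h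
    refine ⟨_, X.face_mem σ hσ _ h, ?_⟩
    rw [map_realMap_comp, mul_inv_cancel, map_realMap_one]
  inter_face := by
    rintro _ ⟨σ, hσ, rfl⟩ _ ⟨τ, hτ, rfl⟩
    rw [map_realMap_inf]
    exact (X.inter_face σ hσ τ hτ).map _ (realMap_injective g)

theorem IsPrimitive.mulVec {u : Fin n → ℤ} (hu : IsPrimitive u) (g : GL (Fin n) ℤ) :
    IsPrimitive ((g : Matrix (Fin n) (Fin n) ℤ) *ᵥ u) := by
  intro a ha
  refine hu a fun i => ?_
  have h : u = ((g⁻¹ : GL (Fin n) ℤ) : Matrix (Fin n) (Fin n) ℤ) *ᵥ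
      ((g : Matrix (Fin n) (Fin n) ℤ) *ᵥ u) := by
    rw [Matrix.mulVec_mulVec, ← Units.val_mul, inv_mul_cancel, Units.val_one, Matrix.one_mulVec]
  rw [h, Matrix.mulVec, dotProduct]
  exact Finset.dvd_sum fun l _ => Dvd.dvd.mul_left (ha l) _

theorem IsDivisor.mulVec {cones : Set (PointedCone ℝ (Fin n → ℝ))} {u : Fin n → ℤ}
    (g : GL (Fin n) ℤ) (hu : IsPrimitive u ∧ PointedCone.hull ℝ {toReal u} ∈ cones) :
    IsPrimitive ((g : Matrix (Fin n) (Fin n) ℤ) *ᵥ u) ∧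
      PointedCone.hull ℝ {toReal ((g : Matrix (Fin n) (Fin n) ℤ) *ᵥ u)} ∈
        PointedCone.map (realMap g) '' cones := by
  refine ⟨hu.1.mulVec g, _, hu.2, ?_⟩
  rw [map_hull_realMap, toReal_mulVec, Set.image_singleton]

/-- A change of lattice coordinates is a bijection on the invariant divisors. -/
theorem isDivisor_map_iff {cones : Set (PointedCone ℝ (Fin n → ℝ))} (g : GL (Fin n) ℤ)
    (u : Fin n → ℤ) :
    (IsPrimitive u ∧ PointedCone.hull ℝ {toReal u} ∈ PointedCone.map (realMap g) '' cones) ↔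
      ∃ v, (IsPrimitive v ∧ PointedCone.hull ℝ {toReal v} ∈ cones) ∧
        u = (g : Matrix (Fin n) (Fin n) ℤ) *ᵥ v := by
  constructor
  · intro h
    refine ⟨((g⁻¹ : GL (Fin n) ℤ) : Matrix (Fin n) (Fin n) ℤ) *ᵥ u, ?_, ?_⟩
    · convert IsDivisor.mulVec g⁻¹ h
      rw [Set.image_image]
      simp only [map_realMap_comp, inv_mul_cancel, map_realMap_one, Set.image_id']
    · rw [Matrix.mulVec_mulVec, ← Units.val_mul, mul_inv_cancel, Units.val_one, Matrix.one_mulVec]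
  · rintro ⟨v, hv, rfl⟩
    exact IsDivisor.mulVec g hv

/-- Since `⟨ξ, g x⟩ = ⟨ξ g, x⟩`, pulling a polyhedron back along the transpose of `g` pushes its
normal cones forward along `g`. -/
theorem normalFan_map (g : GL (Fin n) ℤ) {P P' : Set (Fin n → ℝ)}
    (h : ∀ η, η ∈ P' ↔ η ᵥ* ((g : Matrix (Fin n) (Fin n) ℤ).map (Int.cast : ℤ → ℝ)) ∈ P) :
    normalFan P' = PointedCone.map (realMap g) '' normalFan P := by
  set G := (g : Matrix (Fin n) (Fin n) ℤ).map (Int.cast : ℤ → ℝ) with hG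
  set H := ((g⁻¹ : GL (Fin n) ℤ) : Matrix (Fin n) (Fin n) ℤ).map (Int.cast : ℤ → ℝ) with hH
  have hHG : H * G = 1 := by
    rw [hH, hG, ← Matrix.map_mul_intCast, ← Units.val_mul, inv_mul_cancel]
    simp
  have hinv : ∀ ξ : Fin n → ℝ, (ξ ᵥ* H) ᵥ* G = ξ := fun ξ => by
    rw [Matrix.vecMul_vecMul, hHG, Matrix.vecMul_one]
  have key : ∀ ξ, normalCone P' ξ = PointedCone.map (realMap g) (normalCone P (ξ ᵥ* G)) := by
    intro ξ
    ext x
    obtain ⟨x, rfl⟩ := (realEquiv g).surjective x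
    have hx : realEquiv g x = G *ᵥ x := rfl
    have hmem : realEquiv g x ∈ PointedCone.map (realMap g) (normalCone P (ξ ᵥ* G)) ↔
        x ∈ normalCone P (ξ ᵥ* G) := by
      rw [PointedCone.mem_map]
      exact ⟨fun ⟨y, hy, hyx⟩ => realMap_injective g hyx ▸ hy, fun hx => ⟨x, hx, rfl⟩⟩
    rw [hmem, hx]
    change (∀ η ∈ P', ξ ⬝ᵥ G *ᵥ x ≤ η ⬝ᵥ G *ᵥ x) ↔ ∀ η ∈ P, (ξ ᵥ* G) ⬝ᵥ x ≤ η ⬝ᵥ x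
    simp only [Matrix.dotProduct_mulVec]
    constructor
    · intro hx η hη
      have := hx (η ᵥ* H) ((h _).2 (by rwa [hinv]))
      rwa [hinv] at this
    · exact fun hx η hη => hx _ ((h η).1 hη)
  ext σ
  constructor
  · rintro ⟨ξ, hξ, rfl⟩
    exact ⟨_, ⟨_, (h ξ).1 hξ, rfl⟩, (key ξ).symm⟩
  · rintro ⟨_, ⟨ξ, hξ, rfl⟩, rfl⟩
    refine ⟨ξ ᵥ* H, (h _).2 (by rwa [hinv]), ?_⟩
    rw [key, hinv]

end LatticeCoordinates

/-! ## A polyhedron whose normal fan is the fan of a total space -/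

section TotalSpaceFan

variable {c : ℕ}

theorem chartGen_true_succ (d : Fin c → ℤ) (j : Fin c) :
    chartGen d true j.succ = Pi.single j.succ 1 := rfl

theorem chartGen_false (d : Fin c → ℤ) (i : Fin (c + 1)) :
    chartGen d false i = Pi.single i 1 := rfl

/-- The affine function on `M_ℝ` attached to a generator of a chart cone; the zero section of the
bundle lies over the segment between the vertices of the two charts. -/
def slack (d : Fin c → ℤ) (b : Bool) (i : Fin (c + 1)) (ξ : Fin (c + 1) → ℝ) : ℝ :=
  toReal (chartGen d b i) ⬝ᵥ ξ + if b = true ∧ i = 0 then 1 else 0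

theorem slack_false (d : Fin c → ℤ) (i : Fin (c + 1)) (ξ : Fin (c + 1) → ℝ) :
    slack d false i ξ = ξ i := by
  simp [slack, chartGen_false, toReal_single]

theorem slack_true_succ (d : Fin c → ℤ) (j : Fin c) (ξ : Fin (c + 1) → ℝ) :
    slack d true j.succ ξ = ξ j.succ := by
  simp [slack, chartGen_true_succ, toReal_single]

theorem slack_true_zero (d : Fin c → ℤ) (ξ : Fin (c + 1) → ℝ) :
    slack d true 0 ξ = 1 - ξ 0 - ∑ j, (d j : ℝ) * ξ j.succ := by
  simp [slack, chartGen, dotProduct, Fin.sum_univ_succ, toReal]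
  ring

/-- The two charts share the generators in the fibre directions. -/
theorem slack_succ (d : Fin c → ℤ) (b b' : Bool) (j : Fin c) (ξ : Fin (c + 1) → ℝ) :
    slack d b j.succ ξ = slack d b' j.succ ξ := by
  cases b <;> cases b' <;> simp only [slack_false, slack_true_succ]

theorem slack_add_smul (d : Fin c → ℤ) (b : Bool) (i : Fin (c + 1)) (ξ η : Fin (c + 1) → ℝ)
    (t : ℝ) : slack d b i (ξ + t • η) = slack d b i ξ + t * (toReal (chartGen d b i) ⬝ᵥ η) := by
  rw [slack, slack, dotProduct_add, dotProduct_smul, smul_eq_mul]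
  ring

/-- The polyhedron of the sections of a positive line bundle on the total space. -/
def bundlePolyhedron (d : Fin c → ℤ) : Set (Fin (c + 1) → ℝ) :=
  {ξ | ∀ b i, 0 ≤ slack d b i ξ}

/-- The charts differ in one generator only, so chart `b` sees every inequality but one. -/
theorem mem_bundlePolyhedron_iff (d : Fin c → ℤ) (b : Bool) (ξ : Fin (c + 1) → ℝ) :
    ξ ∈ bundlePolyhedron d ↔ (∀ i, 0 ≤ slack d b i ξ) ∧ 0 ≤ slack d (!b) 0 ξ := by
  refine ⟨fun h => ⟨h b, h _ 0⟩, fun h b' i => ?_⟩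
  by_cases hb : b' = b
  · rw [hb]; exact h.1 i
  · have hb : b' = !b := by revert hb; cases b <;> cases b' <;> simp
    refine Fin.cases (hb ▸ h.2) (fun j => ?_) i
    rw [slack_succ d b' b]
    exact h.1 _

/-- The characters of a chart are dual to its generators: a step along the `i`-th one changes the
`i`-th slack of that chart alone, and possibly the one slack the chart does not see. -/
theorem add_smul_chart_mem {d : Fin c → ℤ} {b : Bool} {ξ : Fin (c + 1) → ℝ}
    (hξ : ξ ∈ bundlePolyhedron d) (i : Fin (c + 1)) {t : ℝ}
    (h1 : 0 ≤ slack d b i ξ + t)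
    (h2 : 0 ≤ slack d (!b) 0 ξ + t * (toReal (chartGen d (!b) 0) ⬝ᵥ toReal (chart d b i))) :
    ξ + t • toReal (chart d b i) ∈ bundlePolyhedron d := by
  rw [mem_bundlePolyhedron_iff d b]
  refine ⟨fun j => ?_, by rwa [slack_add_smul]⟩
  rw [slack_add_smul, dotProduct_comm, chart_dot_chartGen]
  split_ifs with h
  · rw [← h]; simpa using h1
  · simpa using hξ b j

/-- Away from the facet that chart `b` does not see, the polyhedron is locally an orthant in the
slacks of chart `b`. The normal cone is then spanned by the generators whose inequality is tight. -/
theorem normalCone_bundlePolyhedron {d : Fin c → ℤ} {b : Bool} {ξ : Fin (c + 1) → ℝ}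
    (hξ : ξ ∈ bundlePolyhedron d) (h0 : 0 < slack d (!b) 0 ξ) :
    normalCone (bundlePolyhedron d) ξ = chartFace d b {i | 0 < slack d b i ξ} := by
  -- Expansion of `x` in the generators; the constants in the slacks cancel in the difference.
  have hdot : ∀ x η : Fin (c + 1) → ℝ, η ⬝ᵥ x - ξ ⬝ᵥ x =
      ∑ i, (toReal (chart d b i) ⬝ᵥ x) * (slack d b i η - slack d b i ξ) := by
    intro x η
    conv_lhs => rw [chart_expand d b x]
    rw [dotProduct_sum, dotProduct_sum, ← Finset.sum_sub_distrib]
    refine Finset.sum_congr rfl fun i _ => ?_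
    rw [dotProduct_smul, dotProduct_smul, slack, slack, smul_eq_mul, smul_eq_mul,
      dotProduct_comm η, dotProduct_comm ξ]
    ring
  have hsmall : ∀ i, ∃ ε > 0, ∀ t : ℝ, |t| ≤ ε →
      0 ≤ slack d (!b) 0 ξ + t * (toReal (chartGen d (!b) 0) ⬝ᵥ toReal (chart d b i)) := by
    intro i
    set C := toReal (chartGen d (!b) 0) ⬝ᵥ toReal (chart d b i)
    -- The summand `1` avoids division by zero when `C = 0`.
    have hC : 0 < |C| + 1 := by positivity
    refine ⟨slack d (!b) 0 ξ / (|C| + 1), by positivity, fun t ht => ?_⟩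
    have h1 : |t| * (|C| + 1) ≤ slack d (!b) 0 ξ := (le_div_iff₀ hC).1 ht
    have h2 : |t * C| ≤ |t| * (|C| + 1) := by
      rw [abs_mul]; nlinarith [abs_nonneg t]
    linarith [neg_abs_le (t * C)]
  ext x
  rw [mem_chartFace]
  change (∀ η ∈ bundlePolyhedron d, ξ ⬝ᵥ x ≤ η ⬝ᵥ x) ↔ _
  constructor
  · intro hx
    have hmove : ∀ i (t : ℝ), 0 ≤ slack d b i ξ + t → 0 ≤ slack d (!b) 0 ξ +
        t * (toReal (chartGen d (!b) 0) ⬝ᵥ toReal (chart d b i)) →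
        0 ≤ t * (toReal (chart d b i) ⬝ᵥ x) := by
      intro i t h1 h2
      have := hx _ (add_smul_chart_mem hξ i h1 h2)
      rw [add_dotProduct, smul_dotProduct, smul_eq_mul] at this
      linarith
    have hnonneg : ∀ i, 0 ≤ toReal (chart d b i) ⬝ᵥ x := by
      intro i
      obtain ⟨ε, hε, h⟩ := hsmall i
      exact nonneg_of_mul_nonneg_right (hmove i ε (by linarith [hξ b i])
        (h ε (abs_of_pos hε).le)) hε
    refine ⟨hnonneg, fun i hi => le_antisymm ?_ (hnonneg i)⟩
    obtain ⟨ε, hε, h⟩ := hsmall i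
    have hi : 0 < slack d b i ξ := hi
    -- A backward step this short keeps both the `i`-th slack and the unseen one non-negative;
    -- together with the forward step it forces the pairing to vanish.
    have hm : 0 < min ε (slack d b i ξ) := lt_min hε hi
    have := hmove i (-min ε (slack d b i ξ)) (by linarith [min_le_right ε (slack d b i ξ)])
      (h _ (by rw [abs_neg, abs_of_pos hm]; exact min_le_left _ _))
    nlinarith
  · rintro ⟨hx, hx'⟩ η hη
    rw [← sub_nonneg, hdot]
    refine Finset.sum_nonneg fun i _ => ?_
    rcases (hξ b i).lt_or_eq with h | h
    · rw [hx' i h, zero_mul]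
    · rw [← h, sub_zero]
      exact mul_nonneg (hx i) (hη b i)

/-- The two slacks add up to `1 - ∑ d_j ξ_{j+1}`, which is at least `1` when all `d_j ≤ 0`. Hence
the facets over `z = 0` and `z = ∞` do not meet, and every point lies in a chart. -/
theorem exists_slack_pos {d : Fin c → ℤ} (hd : ∀ j, d j ≤ 0) {ξ : Fin (c + 1) → ℝ}
    (hξ : ξ ∈ bundlePolyhedron d) : ∃ b, 0 < slack d (!b) 0 ξ := by
  by_contra hc
  push Not at hc
  have h1 := hc false
  have h2 := hc true
  simp only [Bool.not_false, Bool.not_true, slack_false, slack_true_zero] at h1 h2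
  have h3 : ∑ j, (d j : ℝ) * ξ j.succ ≤ 0 := by
    refine Finset.sum_nonpos fun j _ => mul_nonpos_of_nonpos_of_nonneg ?_ ?_
    · exact_mod_cast hd j
    · have := hξ false j.succ
      rwa [slack_false] at this
  linarith

open Classical in
theorem exists_mem_bundlePolyhedron {d : Fin c → ℤ} (hd : ∀ j, d j ≤ 0) (b : Bool)
    (J : Set (Fin (c + 1))) :
    ∃ ξ ∈ bundlePolyhedron d, 0 < slack d (!b) 0 ξ ∧ {i | 0 < slack d b i ξ} = J := by
  -- Prescribed slacks in chart `b`. A value below `1` keeps the unseen slack `1 - w 0 - ∑ d_j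
  -- w_{j+1}` positive.
  set w : Fin (c + 1) → ℝ := fun i => if i ∈ J then 1 / 2 else 0 with hw
  have hw0 : ∀ i, 0 ≤ w i := fun i => by rw [hw]; dsimp only; split_ifs <;> norm_num
  have hw1 : w 0 ≤ 1 / 2 := by rw [hw]; dsimp only; split_ifs <;> norm_num
  have hwJ : {i | 0 < w i} = J := by
    ext i
    change 0 < w i ↔ i ∈ J
    rw [hw]
    dsimp only
    split_ifs with h <;> simp [h]
  have hsum : ∑ j : Fin c, (d j : ℝ) * w j.succ ≤ 0 :=
    Finset.sum_nonpos fun j _ => mul_nonpos_of_nonpos_of_nonneg (by exact_mod_cast hd j) (hw0 _)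
  suffices h : ∃ ξ, (∀ i, slack d b i ξ = w i) ∧ 0 < slack d (!b) 0 ξ by
    obtain ⟨ξ, h1, h2⟩ := h
    refine ⟨ξ, (mem_bundlePolyhedron_iff d b ξ).2 ⟨fun i => h1 i ▸ hw0 i, h2.le⟩, h2, ?_⟩
    simp only [h1, hwJ]
  cases b
  · refine ⟨w, fun i => slack_false d i w, ?_⟩
    rw [Bool.not_false, slack_true_zero]
    linarith
  -- The first coordinate is the solution of `slack d true 0 ξ = w 0`.
  · refine ⟨Fin.cons (1 - w 0 - ∑ j : Fin c, (d j : ℝ) * w j.succ) (fun j => w j.succ),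
      fun i => ?_, ?_⟩
    · refine Fin.cases ?_ (fun j => ?_) i
      · rw [slack_true_zero]
        simp only [Fin.cons_zero, Fin.cons_succ]
        ring
      · rw [slack_true_succ, Fin.cons_succ]
    · rw [Bool.not_true, slack_false, Fin.cons_zero]
      linarith

/-- The fan of a total space of non-positive line bundles is a normal fan. -/
theorem normalFan_bundlePolyhedron {d : Fin c → ℤ} (hd : ∀ j, d j ≤ 0) :
    normalFan (bundlePolyhedron d) = (totalSpace d).cones := by
  ext σ
  constructor
  · rintro ⟨ξ, hξ, rfl⟩
    obtain ⟨b, hb⟩ := exists_slack_pos hd hξ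
    rw [normalCone_bundlePolyhedron hξ hb]
    exact ⟨b, chartFace_isFaceOf d b _⟩
  · rintro ⟨b, hσ⟩
    obtain ⟨ξ, hξ, h0, hJ⟩ :=
      exists_mem_bundlePolyhedron hd b {i | toReal (chartGen d b i) ∉ σ}
    refine ⟨ξ, hξ, ?_⟩
    rw [normalCone_bundlePolyhedron hξ h0, hJ]
    exact eq_chartFace d b σ hσ

theorem interior_bundlePolyhedron_nonempty {d : Fin c → ℤ} (hd : ∀ j, d j ≤ 0) :
    (interior (bundlePolyhedron d)).Nonempty := by
  -- Taking `J` to be everything makes all inequalities strict at `ξ`, and strict inequalities cut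
  -- out an open set.
  obtain ⟨ξ, -, h0, hJ⟩ := exists_mem_bundlePolyhedron hd false Set.univ
  refine ⟨ξ, mem_interior.2 ⟨{η | ∀ b i, 0 < slack d b i η}, fun η hη b i => (hη b i).le, ?_, ?_⟩⟩
  · have hcont : ∀ b i, Continuous (slack d b i) := fun b i => by
      unfold slack dotProduct; fun_prop
    simp only [Set.ofPred_forall]
    exact isOpen_iInter_of_finite fun b => isOpen_iInter_of_finite fun i =>
      isOpen_lt continuous_const (hcont b i)
  · have h1 : ∀ i, 0 < slack d false i ξ := fun i => by
      have : i ∈ {i | 0 < slack d false i ξ} := hJ ▸ Set.mem_univ i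
      exact this
    intro b i
    cases b
    · exact h1 i
    · exact Fin.cases h0 (fun j => slack_succ d false true j ξ ▸ h1 j.succ) i

end TotalSpaceFan

/-! ## Self-dual models from symmetric changes of coordinates -/

section SelfDual

variable {n : ℕ}

theorem row_dv (cones : Set (PointedCone ℝ (Fin n → ℝ))) (D : Divisors cones) :
    row (dv cones) D = D.1 := by
  ext l
  exact single_one_dotProduct l D.1

theorem row_mon (W : Laurent n) (ξ : Monomials W) : row (mon W) ξ = ξ.1 := by
  ext l
  exact dotProduct_single_one ξ.1 l

theorem isReduction_of_equiv {ι : Type} {A : (Fin n → ℤ) →ₗ[ℤ] (ι → ℤ)}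
    {cones : Set (PointedCone ℝ (Fin n → ℝ))} (e : ι ≃ Divisors cones)
    (h : ∀ i, row A i = (e i).1) :
    IsReduction A cones (LinearMap.funLeft ℤ ℤ e.symm) := by
  classical
  refine ⟨LinearMap.funLeft_surjective_of_injective _ _ _ e.symm.injective, fun i => Or.inr
    ⟨e i, ?_⟩, ?_⟩
  · ext D
    simp only [LinearMap.funLeft_apply, Pi.single_apply, Equiv.symm_apply_eq]
  · ext m D
    simp only [LinearMap.comp_apply, LinearMap.funLeft_apply]
    rw [apply_eq_row_dotProduct, apply_eq_row_dotProduct, h, row_dv, Equiv.apply_symm_apply]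

/-- A class whose polyhedron has the given variety as its normal fan makes linear data with that
variety. -/
theorem isModelOf_of_equiv {ι κ : Type} [Fintype ι] [Fintype κ]
    {A : (Fin n → ℤ) →ₗ[ℤ] (ι → ℤ)} {B : (Fin n → ℤ) →ₗ[ℤ] (κ → ℤ)} {S : Model n}
    (c : ι → ℂ) (ℓ : κ → ℂ) (e : ι ≃ Divisors S.X.cones) (he : ∀ i, row A i = (e i).1)
    (hfan : normalFan (polyhedron A fun i => (c i).im) = S.X.cones)
    (hint : (interior (polyhedron A fun i => (c i).im)).Nonempty)
    (hnonneg : ∀ i j, 0 ≤ row A i ⬝ᵥ row B j)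
    (hW : S.W = ∑ j, AddMonoidAlgebra.single (row B j)
      (Complex.exp (2 * Real.pi * Complex.I * ℓ j)))
    (hK : S.K = cokerClass (dv S.X.cones) fun D => (c (e.symm D) : CModZ)) :
    IsModelOf A (cokerClass A fun i => (c i : CModZ)) B (cokerClass B fun j => (ℓ j : CModZ)) S := by
  have him : imPart A (cokerClass A fun i => (c i : CModZ)) =
      cokerClass A fun i => (c i).im := by
    rw [imPart_cokerClass]; rfl
  have hfan' : fanOf A (cokerClass A fun i => (c i).im) = S.X.cones := by
    rw [fanOf_cokerClass, hfan]
  refine ⟨⟨?_, hnonneg⟩, ?_, ⟨ℓ, rfl, hW⟩, _, isReduction_of_equiv e he, ?_⟩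
  · rw [him]
    refine ⟨⟨_, rfl, hint⟩, ?_⟩
    rw [hfan']
    exact ⟨_, isReduction_of_equiv e he⟩
  · rw [him, hfan']
  · rw [hK, cokerMap_cokerClass e _ _ fun _ _ => rfl]

variable (X : ToricVariety n) (W : Laurent n) (g : GL (Fin n) ℤ) (k : Divisors X.cones → ℂ)

theorem mulVec_injective : Function.Injective fun u : Fin n → ℤ =>
    (g : Matrix (Fin n) (Fin n) ℤ) *ᵥ u :=
  Matrix.mulVec_injective_of_isUnit g.isUnit

/-- The invariant divisors of the image of a toric variety. -/
noncomputable def divisorsMap : Divisors X.cones ≃ Divisors (X.map g).cones :=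
  Equiv.ofBijective (fun D => ⟨_, IsDivisor.mulVec g D.2⟩)
    ⟨fun D D' h => Subtype.ext (mulVec_injective g (congrArg Subtype.val h)), fun D' => by
      obtain ⟨v, hv, h⟩ := (isDivisor_map_iff g D'.1).1 D'.2
      exact ⟨⟨v, hv⟩, Subtype.ext h.symm⟩⟩

variable {X W g}

/-- The bijection of the invariant divisors with the monomials of a superpotential. -/
noncomputable def divisorsMonomials
    (hW : ∀ m, m ∈ W.coeff.support ↔
      ∃ D : Divisors X.cones, m = (g : Matrix (Fin n) (Fin n) ℤ) *ᵥ D.1) :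
    Divisors X.cones ≃ Monomials W :=
  Equiv.ofBijective (fun D => ⟨_, (hW _).2 ⟨D, rfl⟩⟩)
    ⟨fun D D' h => Subtype.ext (mulVec_injective g (congrArg Subtype.val h)), fun ξ => by
      obtain ⟨D, hD⟩ := (hW ξ.1).1 ξ.2
      exact ⟨D, Subtype.ext hD.symm⟩⟩

theorem divisorsMonomials_val
    (hW : ∀ m, m ∈ W.coeff.support ↔
      ∃ D : Divisors X.cones, m = (g : Matrix (Fin n) (Fin n) ℤ) *ᵥ D.1)
    (D : Divisors X.cones) :
    (divisorsMonomials hW D).1 = (g : Matrix (Fin n) (Fin n) ℤ) *ᵥ D.1 := rfl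

theorem mulVec_dotProduct_of_symm (hg : (g : Matrix (Fin n) (Fin n) ℤ)ᵀ = g) (u v : Fin n → ℤ) :
    ((g : Matrix (Fin n) (Fin n) ℤ) *ᵥ u) ⬝ᵥ v = u ⬝ᵥ ((g : Matrix (Fin n) (Fin n) ℤ) *ᵥ v) := by
  rw [Matrix.dotProduct_mulVec, ← Matrix.mulVec_transpose, hg]

theorem toReal_dotProduct (u v : Fin n → ℤ) : toReal u ⬝ᵥ toReal v = ((u ⬝ᵥ v : ℤ) : ℝ) := by
  simp [toReal, dotProduct]

theorem toReal_dotProduct_realMap (g : GL (Fin n) ℤ) (u : Fin n → ℤ) (x : Fin n → ℝ) :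
    toReal u ⬝ᵥ realMap g x = toReal (u ᵥ* (g : Matrix (Fin n) (Fin n) ℤ)) ⬝ᵥ x := by
  rw [realMap, Matrix.mulVecLin_apply, Matrix.dotProduct_mulVec]
  congr 1
  ext i
  simp [toReal, Matrix.vecMul, dotProduct]

theorem IsRegular.dotProduct_nonneg {W : Laurent n} (h : IsRegular X W) {ξ : Fin n → ℤ}
    (hξ : ξ ∈ W.coeff.support) (D : Divisors X.cones) : 0 ≤ ξ ⬝ᵥ D.1 := by
  have := h ξ hξ _ D.2.2 (toReal D.1) (Submodule.mem_span_singleton_self _)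
  rw [toReal_dotProduct] at this
  exact_mod_cast this

theorem interior_nonempty_of_vecMul (g : GL (Fin n) ℤ) {P P' : Set (Fin n → ℝ)}
    (h : ∀ η, η ∈ P' ↔ η ᵥ* ((g : Matrix (Fin n) (Fin n) ℤ).map (Int.cast : ℤ → ℝ)) ∈ P)
    (hP : (interior P).Nonempty) : (interior P').Nonempty := by
  obtain ⟨ξ, hξ⟩ := hP
  set G := (g : Matrix (Fin n) (Fin n) ℤ).map (Int.cast : ℤ → ℝ) with hG
  have hHG : ((g⁻¹ : GL (Fin n) ℤ) : Matrix (Fin n) (Fin n) ℤ).map (Int.cast : ℤ → ℝ) * G = 1 := by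
    rw [hG, ← Matrix.map_mul_intCast, ← Units.val_mul, inv_mul_cancel]
    simp
  have hcont : Continuous fun η : Fin n → ℝ => η ᵥ* G := by fun_prop
  have hP' : P' = (fun η : Fin n → ℝ => η ᵥ* G) ⁻¹' P := Set.ext h
  rw [hP']
  refine ⟨ξ ᵥ* ((g⁻¹ : GL (Fin n) ℤ) : Matrix (Fin n) (Fin n) ℤ).map (Int.cast : ℤ → ℝ),
    preimage_interior_subset_interior_preimage hcont ?_⟩
  rw [Set.mem_preimage, Matrix.vecMul_vecMul, hHG, Matrix.vecMul_one]
  exact hξ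

/-- The superpotential whose monomials are the ray generators of a toric variety. -/
noncomputable def rayPotential (k : Divisors X.cones → ℂ) : Laurent n :=
  ∑ D : Divisors X.cones, AddMonoidAlgebra.single D.1 (Complex.exp (2 * Real.pi * Complex.I * k D))

theorem coeff_rayPotential (D : Divisors X.cones) :
    (rayPotential k).coeff D.1 = Complex.exp (2 * Real.pi * Complex.I * k D) := by
  classical
  rw [rayPotential, AddMonoidAlgebra.coeff_sum, Finsupp.finsetSum_apply, Finset.sum_eq_single D]
  · simp
  · intro D' _ h
    rw [AddMonoidAlgebra.coeff_single, Finsupp.single_apply, if_neg]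
    exact fun h' => h (Subtype.ext h')
  · simp

theorem exists_of_coeff_rayPotential_ne_zero {m : Fin n → ℤ} (h : (rayPotential k).coeff m ≠ 0) :
    ∃ D : Divisors X.cones, m = D.1 := by
  classical
  by_contra hc
  push Not at hc
  refine h ?_
  rw [rayPotential, AddMonoidAlgebra.coeff_sum, Finsupp.finsetSum_apply]
  refine Finset.sum_eq_zero fun D _ => ?_
  rw [AddMonoidAlgebra.coeff_single, Finsupp.single_apply, if_neg (hc D).symm]

/-- If the ray generators of `X` are carried to the monomials of `W` by a symmetric matrix, then `X`
and `W` belong to a self-dual model, with the class given by an ample divisor. -/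
theorem exists_isSelfDual (hg : (g : Matrix (Fin n) (Fin n) ℤ)ᵀ = g)
    (hW : ∀ m, m ∈ W.coeff.support ↔
      ∃ D : Divisors X.cones, m = (g : Matrix (Fin n) (Fin n) ℤ) *ᵥ D.1)
    (hcoeff : ∀ D : Divisors X.cones, W.coeff ((g : Matrix (Fin n) (Fin n) ℤ) *ᵥ D.1) =
      Complex.exp (2 * Real.pi * Complex.I * k D))
    (hreg : IsRegular X W)
    (hfan : normalFan (polyhedron (dv X.cones) fun D => (k D).im) = X.cones)
    (hint : (interior (polyhedron (dv X.cones) fun D => (k D).im)).Nonempty) :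
    ∃ S : Model n, S.X = X ∧ S.W = W ∧ S.IsSelfDual := by
  set eM := divisorsMonomials hW with heM
  set eD := divisorsMap X g with heD
  -- Symmetry of `g` enters here: fans move by `g` and monomials by its transpose, and the two
  -- actions have to agree.
  have hvecMul : ∀ m : Fin n → ℤ, m ᵥ* (g : Matrix (Fin n) (Fin n) ℤ) =
      (g : Matrix (Fin n) (Fin n) ℤ) *ᵥ m := fun m => by rw [← Matrix.mulVec_transpose, hg]
  have hreg' : IsRegular (X.map g) (rayPotential k) := by
    rintro ξ hξ _ ⟨σ, hσ, rfl⟩ x hx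
    obtain ⟨y, hy, rfl⟩ := PointedCone.mem_map.1 hx
    obtain ⟨D, rfl⟩ := exists_of_coeff_rayPotential_ne_zero k (Finsupp.mem_support_iff.1 hξ)
    -- The pairing `⟨v_D, g y⟩` equals `⟨g v_D, y⟩`, and `g v_D` is a monomial of the regular
    -- function `W`.
    rw [toReal_dotProduct_realMap, hvecMul]
    exact hreg _ ((hW _).2 ⟨D, rfl⟩) σ hσ y hy
  have hrow : ∀ ξ : Monomials W, row (mon W) ξ =
      (g : Matrix (Fin n) (Fin n) ℤ) *ᵥ (eM.symm ξ).1 := by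
    intro ξ
    obtain ⟨D, rfl⟩ := eM.surjective ξ
    rw [Equiv.symm_apply_apply, row_mon, heM, divisorsMonomials_val]
  have hpoly : ∀ η : Fin n → ℝ,
      η ∈ polyhedron (mon W) (fun ξ => (k (eM.symm ξ)).im) ↔
        η ᵥ* ((g : Matrix (Fin n) (Fin n) ℤ).map (Int.cast : ℤ → ℝ)) ∈
          polyhedron (dv X.cones) fun D => (k D).im := by
    intro η
    change (∀ ξ, 0 ≤ toReal (row (mon W) ξ) ⬝ᵥ η + _) ↔
      ∀ D, 0 ≤ toReal (row (dv X.cones) D) ⬝ᵥ _ + _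
    rw [← eM.forall_congr_right]
    refine forall_congr' fun D => ?_
    rw [hrow, Equiv.symm_apply_apply, row_dv, toReal_mulVec, realMap, Matrix.mulVecLin_apply,
      dotProduct_comm, Matrix.dotProduct_mulVec, dotProduct_comm]
  let S : Model n := ⟨X, W, hreg, cokerClass (dv X.cones) fun D => (k D : CModZ)⟩
  let S' : Model n := ⟨X.map g, rayPotential k, hreg',
    cokerClass (dv (X.map g).cones) fun D => (k (eD.symm D) : CModZ)⟩
  have hnonneg : ∀ (D : Divisors X.cones) (ξ : Monomials W),
      0 ≤ row (dv X.cones) D ⬝ᵥ row (mon W) ξ := by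
    intro D ξ
    rw [row_dv, row_mon, dotProduct_comm]
    exact hreg.dotProduct_nonneg ξ.2 D
  -- The class `L` is represented by the same numbers `k`, carried from divisors to monomials.
  refine ⟨S, rfl, rfl, S', ⟨cokerClass (mon W) fun ξ => (k (eM.symm ξ) : CModZ), ?_, ?_⟩, ?_⟩
  · refine isModelOf_of_equiv (S := S) k (fun ξ => k (eM.symm ξ)) (Equiv.refl _) (row_dv _) hfan
      hint hnonneg ?_ rfl
    change W = _
    conv_lhs => rw [← AddMonoidAlgebra.sum_coeff_single W, Finsupp.sum, ← Finset.sum_coe_sort]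
    refine Finset.sum_congr rfl fun ξ _ => ?_
    obtain ⟨D, rfl⟩ := eM.surjective ξ
    rw [Equiv.symm_apply_apply, row_mon, ← hcoeff D]
    rfl
  · refine isModelOf_of_equiv (S := S') (fun ξ => k (eM.symm ξ)) k (eM.symm.trans eD) hrow ?_ ?_
      (fun ξ D => by rw [dotProduct_comm]; exact hnonneg D ξ) ?_ ?_
    · rw [normalFan_map g hpoly, hfan]
      rfl
    · exact interior_nonempty_of_vecMul g hpoly hint
    · change rayPotential k = _
      simp only [row_dv]
      rfl
    · change cokerClass _ _ = cokerClass _ _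
      simp only [Equiv.symm_trans_apply, Equiv.symm_symm, Equiv.symm_apply_apply]
      rfl
  -- No torus translation is needed, because the coefficients agree exactly.
  · refine ⟨g, 1, rfl, fun m => ?_, _, _, rfl, rfl, fun D D' h => ?_⟩
    · change W.coeff _ = _ * (rayPotential k).coeff m
      rw [hvecMul]
      simp only [Pi.one_apply, one_zpow, Finset.prod_const_one, Units.val_one, one_mul]
      by_cases hm : ∃ D : Divisors X.cones, m = D.1
      · obtain ⟨D, rfl⟩ := hm
        rw [hcoeff, coeff_rayPotential]
      · rw [not_imp_comm.1 (exists_of_coeff_rayPotential_ne_zero k) hm,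
          ← Finsupp.notMem_support_iff, hW]
        exact fun ⟨D, hD⟩ => hm ⟨D, mulVec_injective g hD⟩
    · have : D' = eD D := Subtype.ext h
      rw [this, Equiv.symm_apply_apply]

end SelfDual

/-! ## Self-duality of total spaces -/

section TotalSpaceSelfDual

variable {c : ℕ}

/-- This is the only generator with a negative first coordinate. -/
theorem chartGen_eq_iff (d : Fin c → ℤ) (b : Bool) (i : Fin (c + 1)) :
    chartGen d b i = chartGen d true 0 ↔ b = true ∧ i = 0 := by
  refine ⟨fun h => ?_, fun h => by rw [h.1, h.2]⟩
  have h0 := congrFun h 0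
  have h1 : chartGen d true 0 0 = -1 := rfl
  rw [h1] at h0
  cases b
  · rw [chartGen_false, Pi.single_apply] at h0
    split_ifs at h0
  · refine ⟨rfl, ?_⟩
    revert h0
    refine Fin.cases (fun _ => rfl) (fun j h0 => ?_) i
    rw [chartGen_true_succ, Pi.single_apply, if_neg (Fin.succ_ne_zero j).symm] at h0
    omega

theorem isRegular_totalSpace {d : Fin c → ℤ} {W : Laurent (c + 1)}
    (h : ∀ ξ ∈ W.coeff.support, ∀ b i, 0 ≤ ξ ⬝ᵥ chartGen d b i) : IsRegular (totalSpace d) W := by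
  rintro ξ hξ σ ⟨b, hσ⟩ x hx
  rw [chart_expand d b x, dotProduct_sum]
  refine Finset.sum_nonneg fun i _ => ?_
  rw [dotProduct_smul, toReal_dotProduct]
  exact mul_nonneg (hσ.le hx i) (by exact_mod_cast h ξ hξ b i)

theorem eq_zero_of_dotProduct_chartGen {d : Fin c → ℤ} {m : Fin (c + 1) → ℤ}
    (h : ∀ b i, m ⬝ᵥ chartGen d b i = 0) : m = 0 := by
  ext i
  have := h false i
  rwa [chartGen_false, dotProduct_single_one] at this

/-- The class is `i` times the fibre over `z = ∞`. Its imaginary part yields `bundlePolyhedron d`,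
and it prescribes the coefficient `exp(2πi · i)` for the matching monomial. -/
theorem exists_isSelfDual_totalSpace {d : Fin c → ℤ} (hd : ∀ j, d j ≤ 0) {W : Laurent (c + 1)}
    {g : GL (Fin (c + 1)) ℤ} (hg : (g : Matrix (Fin (c + 1)) (Fin (c + 1)) ℤ)ᵀ = g)
    (hW : ∀ m, m ∈ W.coeff.support ↔
      ∃ b i, m = (g : Matrix (Fin (c + 1)) (Fin (c + 1)) ℤ) *ᵥ chartGen d b i)
    (hcoeff : ∀ b i, W.coeff ((g : Matrix (Fin (c + 1)) (Fin (c + 1)) ℤ) *ᵥ chartGen d b i) =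
      if b = true ∧ i = 0 then Complex.exp (2 * Real.pi * Complex.I * Complex.I) else 1)
    (hreg : ∀ b i b' i', 0 ≤ ((g : Matrix (Fin (c + 1)) (Fin (c + 1)) ℤ) *ᵥ chartGen d b i) ⬝ᵥ
      chartGen d b' i') :
    ∃ S : Model (c + 1), S.X = totalSpace d ∧ S.W = W ∧ S.IsSelfDual := by
  classical
  set k : Divisors (totalSpace d).cones → ℂ :=
    fun D => if D.1 = chartGen d true 0 then Complex.I else 0 with hk
  have hpoly : polyhedron (dv (totalSpace d).cones) (fun D => (k D).im) = bundlePolyhedron d := by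
    ext ξ
    change (∀ D, 0 ≤ toReal (row (dv (totalSpace d).cones) D) ⬝ᵥ ξ + (k D).im) ↔
      ∀ b i, 0 ≤ slack d b i ξ
    simp only [row_dv]
    have him : ∀ D b i, D.1 = chartGen d b i →
        toReal D.1 ⬝ᵥ ξ + (k D).im = slack d b i ξ := by
      intro D b i h
      rw [slack, hk, h]
      simp only [chartGen_eq_iff, h]
      split_ifs <;> simp
    constructor
    · intro h b i
      obtain ⟨D, hD⟩ : ∃ D : Divisors (totalSpace d).cones, D.1 = chartGen d b i :=
        ⟨⟨_, (isDivisor_totalSpace_iff d _).2 ⟨b, i, rfl⟩⟩, rfl⟩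
      exact him D b i hD ▸ h D
    · intro h D
      obtain ⟨b, i, hD⟩ := (isDivisor_totalSpace_iff d D.1).1 D.2
      rw [him D b i hD]
      exact h b i
  refine exists_isSelfDual k hg (fun m => (hW m).trans ?_) (fun D => ?_) ?_ ?_ ?_
  · constructor
    · rintro ⟨b, i, rfl⟩
      exact ⟨⟨_, (isDivisor_totalSpace_iff d _).2 ⟨b, i, rfl⟩⟩, rfl⟩
    · rintro ⟨D, rfl⟩
      obtain ⟨b, i, hD⟩ := (isDivisor_totalSpace_iff d D.1).1 D.2
      exact ⟨b, i, by rw [hD]⟩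
  · obtain ⟨b, i, hD⟩ := (isDivisor_totalSpace_iff d D.1).1 D.2
    rw [hD, hcoeff, hk]
    simp only [hD, chartGen_eq_iff]
    split_ifs <;> simp
  · refine isRegular_totalSpace fun ξ hξ b' i' => ?_
    obtain ⟨b, i, rfl⟩ := (hW ξ).1 hξ
    exact hreg b i b' i'
  · rw [hpoly, normalFan_bundlePolyhedron hd]
  · rw [hpoly]
    exact interior_bundlePolyhedron_nonempty hd

end TotalSpaceSelfDual

/-! ## Matrices -/

section Matrices

/-- This trades orderings of subtypes for injective families of vectors, which puts `dv` and `mon`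
matrices in one form. -/
theorem exists_equiv_subtype_iff {n : ℕ} {ι J : Type} (p : (Fin n → ℤ) → Prop)
    (D : Matrix ι J ℤ) (b : J → Fin n → ℤ) :
    (∃ e : ι ≃ {v // p v}, ∀ i j, D i j = (e i).1 ⬝ᵥ b j) ↔
      ∃ u : ι → Fin n → ℤ, Function.Injective u ∧ (∀ v, p v ↔ ∃ i, v = u i) ∧
        ∀ i j, D i j = u i ⬝ᵥ b j := by
  constructor
  · rintro ⟨e, h⟩
    refine ⟨fun i => (e i).1, fun i i' h => e.injective (Subtype.ext h), fun v => ?_, h⟩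
    refine ⟨fun hv => ⟨e.symm ⟨v, hv⟩, by simp⟩, ?_⟩
    rintro ⟨i, rfl⟩
    exact (e i).2
  · rintro ⟨u, hu, hp, h⟩
    refine ⟨Equiv.ofBijective (fun i => ⟨u i, (hp _).2 ⟨i, rfl⟩⟩)
      ⟨fun i i' h => hu (congrArg Subtype.val h), fun v => ?_⟩, h⟩
    obtain ⟨i, hi⟩ := (hp v.1).1 v.2
    exact ⟨i, Subtype.ext hi.symm⟩

theorem isDvMatrix_iff {n : ℕ} {ι J : Type} (X : ToricVariety n) (D : Matrix ι J ℤ) :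
    IsDvMatrix X D ↔ ∃ (b : Module.Basis J ℤ (Fin n → ℤ)) (u : ι → Fin n → ℤ),
      Function.Injective u ∧
      (∀ v, (IsPrimitive v ∧ PointedCone.hull ℝ {toReal v} ∈ X.cones) ↔ ∃ i, v = u i) ∧
        ∀ i j, D i j = u i ⬝ᵥ b j := by
  refine exists_congr fun b => ?_
  rw [← exists_equiv_subtype_iff _ D b]
  refine exists_congr fun e => forall_congr' fun i => forall_congr' fun j => ?_
  rw [dotProduct_comm]
  rfl

theorem isMonMatrix_iff {n : ℕ} {ι J : Type} (W : Laurent n) (E : Matrix ι J ℤ) :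
    IsMonMatrix W E ↔ ∃ (b : Module.Basis J ℤ (Fin n → ℤ)) (u : ι → Fin n → ℤ),
      Function.Injective u ∧ (∀ v, v ∈ W.coeff.support ↔ ∃ i, v = u i) ∧
        ∀ i j, E i j = u i ⬝ᵥ b j := by
  refine exists_congr fun b => ?_
  rw [← exists_equiv_subtype_iff _ E b]
  rfl

/-- The insertion of a middle coordinate. -/
def insertMiddle : ((Fin 2 → ℤ) × ℤ) ≃ₗ[ℤ] (Fin 3 → ℤ) where
  toFun p := ![p.1 0, p.2, p.1 1]
  invFun v := (![v 0, v 2], v 1)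
  map_add' p q := by ext i; fin_cases i <;> rfl
  map_smul' a p := by ext i; fin_cases i <;> rfl
  left_inv p := by
    refine Prod.ext ?_ rfl
    ext i; fin_cases i <;> rfl
  right_inv v := by ext i; fin_cases i <;> rfl

theorem insertMiddle_dotProduct (p q : (Fin 2 → ℤ) × ℤ) :
    insertMiddle p ⬝ᵥ insertMiddle q = p.1 ⬝ᵥ q.1 + p.2 * q.2 := by
  simp [insertMiddle, dotProduct, Fin.sum_univ_succ]
  ring

/-- One statement serves both splittings: `p` and `q` stand for rays or for monomials. The inserted
coordinate is the middle one because the trivial summand of `W_0` has fibre coordinate `t₂`. -/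
theorem exists_fromBlocks {ι J : Type} {D : Matrix ι J ℤ} {p : (Fin 2 → ℤ) → Prop}
    {q : (Fin 3 → ℤ) → Prop}
    (h : ∃ (b : Module.Basis J ℤ (Fin 2 → ℤ)) (u : ι → Fin 2 → ℤ), Function.Injective u ∧
      (∀ v, p v ↔ ∃ i, v = u i) ∧ ∀ i j, D i j = u i ⬝ᵥ b j)
    (hq : ∀ x y, q (insertMiddle (x, y)) ↔ (p x ∧ y = 0) ∨ (x = 0 ∧ y = 1)) :
    ∃ (b : Module.Basis (J ⊕ Unit) ℤ (Fin 3 → ℤ)) (u : ι ⊕ Unit → Fin 3 → ℤ),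
      Function.Injective u ∧ (∀ v, q v ↔ ∃ i, v = u i) ∧
      ∀ i j, Matrix.fromBlocks D 0 0 (1 : Matrix Unit Unit ℤ) i j = u i ⬝ᵥ b j := by
  obtain ⟨b, u, hu, hp, hD⟩ := h
  refine ⟨(b.prod (Module.Basis.singleton Unit ℤ)).map insertMiddle,
    Sum.elim (fun i => insertMiddle (u i, 0)) (fun _ => insertMiddle (0, 1)), ?_, fun v => ?_, ?_⟩
  · rintro (i | i) (j | j) hij <;> simp at hij ⊢
    exact hu hij
  · obtain ⟨⟨x, y⟩, rfl⟩ := insertMiddle.surjective v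
    rw [hq, hp]
    simp only [Sum.exists, Sum.elim_inl, Sum.elim_inr, EmbeddingLike.apply_eq_iff_eq,
      Prod.mk.injEq, exists_const, exists_and_right]
  · rintro (i | i) (j | j) <;>
      simp [insertMiddle_dotProduct, hD]

/-- Of the six generators of the two charts, the two fibre directions occur twice. -/
theorem exists_chartGen_rank_two (k l : ℤ) (u : Fin 3 → ℤ) :
    (∃ b i, u = chartGen ![k, l] b i) ↔
      u = ![1, 0, 0] ∨ u = ![-1, -k, -l] ∨ u = ![0, 1, 0] ∨ u = ![0, 0, 1] := by
  have h1 : ∀ b, chartGen ![k, l] b 1 = ![0, 1, 0] := by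
    intro b; cases b <;> (ext i; fin_cases i <;> rfl)
  have h2 : ∀ b, chartGen ![k, l] b 2 = ![0, 0, 1] := by
    intro b; cases b <;> (ext i; fin_cases i <;> rfl)
  have h3 : chartGen ![k, l] false 0 = ![1, 0, 0] := by ext i; fin_cases i <;> rfl
  have h4 : chartGen ![k, l] true 0 = ![-1, -k, -l] := by ext i; fin_cases i <;> rfl
  rw [Bool.exists_bool, Fin.exists_fin_succ, Fin.exists_fin_succ, Fin.exists_fin_succ,
    Fin.exists_fin_succ, Fin.exists_fin_succ, Fin.exists_fin_succ]
  simp only [IsEmpty.exists_iff, or_false]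
  change ((u = chartGen ![k, l] false 0) ∨ (u = chartGen ![k, l] false 1) ∨
    (u = chartGen ![k, l] false 2)) ∨ (u = chartGen ![k, l] true 0) ∨
    (u = chartGen ![k, l] true 1) ∨ (u = chartGen ![k, l] true 2) ↔ _
  rw [h1, h1, h2, h2, h3, h4]
  tauto

theorem exists_chartGen_rank_one (k : ℤ) (u : Fin 2 → ℤ) :
    (∃ b i, u = chartGen ![k] b i) ↔ u = ![1, 0] ∨ u = ![-1, -k] ∨ u = ![0, 1] := by
  have h1 : ∀ b, chartGen ![k] b 1 = ![0, 1] := by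
    intro b; cases b <;> (ext i; fin_cases i <;> rfl)
  have h3 : chartGen ![k] false 0 = ![1, 0] := by ext i; fin_cases i <;> rfl
  have h4 : chartGen ![k] true 0 = ![-1, -k] := by ext i; fin_cases i <;> rfl
  rw [Bool.exists_bool, Fin.exists_fin_succ, Fin.exists_fin_succ, Fin.exists_fin_succ,
    Fin.exists_fin_succ]
  simp only [IsEmpty.exists_iff, or_false]
  change ((u = chartGen ![k] false 0) ∨ (u = chartGen ![k] false 1)) ∨
    (u = chartGen ![k] true 0) ∨ (u = chartGen ![k] true 1) ↔ _
  rw [h1, h1, h3, h4]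
  tauto

theorem vec_three_eq_iff (u : Fin 3 → ℤ) (x y z : ℤ) :
    u = ![x, y, z] ↔ u 0 = x ∧ u 1 = y ∧ u 2 = z := by
  simp [funext_iff, Fin.forall_fin_succ]

theorem vec_two_eq_iff (u : Fin 2 → ℤ) (x y : ℤ) : u = ![x, y] ↔ u 0 = x ∧ u 1 = y := by
  simp [funext_iff, Fin.forall_fin_succ]

theorem isDvMatrix_fromBlocks {ι J : Type} {D : Matrix ι J ℤ}
    (h : IsDvMatrix (totalSpace ![-2]) D) :
    IsDvMatrix (Wk 0) (Matrix.fromBlocks D 0 0 (1 : Matrix Unit Unit ℤ)) := by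
  rw [isDvMatrix_iff] at h ⊢
  refine exists_fromBlocks h fun x y => ?_
  rw [Wk, isDivisor_totalSpace_iff, isDivisor_totalSpace_iff, exists_chartGen_rank_two,
    exists_chartGen_rank_one]
  have hx : x = 0 ↔ x 0 = 0 ∧ x 1 = 0 := by simp [funext_iff, Fin.forall_fin_succ]
  simp only [vec_three_eq_iff, vec_two_eq_iff, hx]
  change ((x 0 = _ ∧ y = _ ∧ x 1 = _) ∨ (x 0 = _ ∧ y = _ ∧ x 1 = _) ∨
    (x 0 = _ ∧ y = _ ∧ x 1 = _) ∨ (x 0 = _ ∧ y = _ ∧ x 1 = _)) ↔ _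
  omega

theorem mem_support_superpotential_one (f : ℂ[X]) (m : Fin 2 → ℤ) :
    m ∈ (superpotential ![f]).coeff.support ↔
      ∃ i : ℕ, f.coeff i ≠ 0 ∧ m 0 = i ∧ m 1 = 1 := by
  rw [mem_support_superpotential, Fin.exists_fin_one]
  refine exists_congr fun i => and_congr Iff.rfl ?_
  simp [funext_iff, Fin.forall_fin_succ]

theorem mem_support_superpotential_two (f₁ f₂ : ℂ[X]) (m : Fin 3 → ℤ) :
    m ∈ (superpotential ![f₁, f₂]).coeff.support ↔
      (∃ i : ℕ, f₁.coeff i ≠ 0 ∧ m 0 = i ∧ m 1 = 1 ∧ m 2 = 0) ∨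
      ∃ i : ℕ, f₂.coeff i ≠ 0 ∧ m 0 = i ∧ m 1 = 0 ∧ m 2 = 1 := by
  rw [mem_support_superpotential, Fin.exists_fin_two]
  refine or_congr ?_ ?_ <;> refine exists_congr fun i => and_congr Iff.rfl ?_ <;>
    simp [funext_iff, Fin.forall_fin_succ]

/-- A non-zero section of `𝒪` is a non-zero constant, so it contributes exactly the monomial `t₂`.
-/
theorem isMonMatrix_fromBlocks {f₁ f₂ : ℂ[X]} (h₁ : IsSection 0 f₁) (h0 : f₁ ≠ 0) {ι J : Type}
    {E : Matrix ι J ℤ} (h : IsMonMatrix (superpotential ![f₂]) E) :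
    IsMonMatrix (superpotential ![f₁, f₂])
      (Matrix.fromBlocks E 0 0 (1 : Matrix Unit Unit ℤ)) := by
  rw [isMonMatrix_iff] at h ⊢
  refine exists_fromBlocks h fun x y => ?_
  have hf : ∀ i, f₁.coeff i ≠ 0 ↔ i = 0 := by
    have hpos : ∀ i, i ≠ 0 → f₁.coeff i = 0 := fun i hi => h₁.coeff_eq_zero (by omega)
    refine fun i => ⟨fun hi => not_imp_comm.1 (hpos i) hi, ?_⟩
    rintro rfl hc
    refine h0 (Polynomial.ext fun i => ?_)
    by_cases hi : i = 0
    · rw [hi, hc, Polynomial.coeff_zero]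
    · rw [hpos i hi, Polynomial.coeff_zero]
  have hx : x = 0 ↔ x 0 = 0 ∧ x 1 = 0 := by simp [funext_iff, Fin.forall_fin_succ]
  rw [mem_support_superpotential_two, mem_support_superpotential_one, hx]
  simp only [hf]
  change (∃ i : ℕ, i = 0 ∧ x 0 = i ∧ y = 1 ∧ x 1 = 0) ∨
    (∃ i : ℕ, f₂.coeff i ≠ 0 ∧ x 0 = i ∧ y = 0 ∧ x 1 = 1) ↔ _
  constructor
  · rintro (⟨i, rfl, h1, h2, h3⟩ | ⟨i, hi, h1, h2, h3⟩)
    · exact Or.inr ⟨⟨by simpa using h1, h3⟩, h2⟩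
    · exact Or.inl ⟨⟨i, hi, h1, h3⟩, h2⟩
  · rintro (⟨⟨i, hi, h1, h3⟩, h2⟩ | ⟨⟨h1, h3⟩, h2⟩)
    · exact Or.inr ⟨i, hi, h1, h2, h3⟩
    · exact Or.inl ⟨0, rfl, by simpa using h1, h2, h3⟩

/-- The matrix of ray generators of `W_k`. -/
def rayMatrix (k : ℤ) : Matrix (Fin 4) (Fin 3) ℤ := !![1, 0, 0; -1, -k, k + 2; 0, 1, 0; 0, 0, 1]

theorem rayMatrix_injective (k : ℤ) : Function.Injective (rayMatrix k) := by
  have h0 : rayMatrix k 0 = ![1, 0, 0] := rfl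
  have h1 : rayMatrix k 1 = ![-1, -k, k + 2] := rfl
  have h2 : rayMatrix k 2 = ![0, 1, 0] := rfl
  have h3 : rayMatrix k 3 = ![0, 0, 1] := rfl
  intro i j h
  fin_cases i <;> fin_cases j <;> simp [h0, h1, h2, h3] at h ⊢

theorem exists_rayMatrix (k : ℤ) (u : Fin 3 → ℤ) :
    (∃ i, u = rayMatrix k i) ↔ ∃ b i, u = chartGen ![k, -k - 2] b i := by
  rw [exists_chartGen_rank_two, show -(-k - 2) = k + 2 by ring]
  constructor
  · rintro ⟨i, rfl⟩
    fin_cases i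
    · exact Or.inl rfl
    · exact Or.inr (Or.inl rfl)
    · exact Or.inr (Or.inr (Or.inl rfl))
    · exact Or.inr (Or.inr (Or.inr rfl))
  · rintro (rfl | rfl | rfl | rfl)
    exacts [⟨0, rfl⟩, ⟨1, rfl⟩, ⟨2, rfl⟩, ⟨3, rfl⟩]

theorem isDvMatrix_rayMatrix (k : ℤ) : IsDvMatrix (Wk k) (rayMatrix k) := by
  rw [isDvMatrix_iff]
  refine ⟨Pi.basisFun ℤ (Fin 3), rayMatrix k, rayMatrix_injective k, fun v => ?_, fun i j => ?_⟩
  · rw [exists_rayMatrix, Wk, isDivisor_totalSpace_iff]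
  · simp

/-- In the basis `g⁻¹ e_j` of `N` the monomials `g E_i` have pairings `⟨g E_i, g⁻¹ e_j⟩ = ⟨E_i,
e_j⟩`, by symmetry. -/
theorem isMonMatrix_of_symm {n : ℕ} {ι : Type} {W : Laurent n} {E : Matrix ι (Fin n) ℤ}
    (hE : Function.Injective E) {g : GL (Fin n) ℤ}
    (hg : (g : Matrix (Fin n) (Fin n) ℤ)ᵀ = g)
    (hW : ∀ m, m ∈ W.coeff.support ↔ ∃ i, m = (g : Matrix (Fin n) (Fin n) ℤ) *ᵥ E i) :
    IsMonMatrix W E := by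
  rw [isMonMatrix_iff]
  refine ⟨(Pi.basisFun ℤ (Fin n)).map (Matrix.toLin'OfInv (M := g.1)
    (M' := (g⁻¹ : GL (Fin n) ℤ).1) (by simp) (by simp)), fun i => (g : Matrix (Fin n) (Fin n) ℤ) *ᵥ E i,
    fun i j h => hE (mulVec_injective g h), hW, fun i j => ?_⟩
  rw [mulVec_dotProduct_of_symm hg, Module.Basis.map_apply, Pi.basisFun_apply]
  change _ = E i ⬝ᵥ (g.1 *ᵥ Matrix.toLin' (g⁻¹ : GL (Fin n) ℤ).1 (Pi.single j 1))
  rw [Matrix.toLin'_apply, Matrix.mulVec_mulVec, ← Units.val_mul, mul_inv_cancel, Units.val_one,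
    Matrix.one_mulVec, dotProduct_single_one]

end Matrices

/-! ## The cases `k = 0` and `k = -1` -/

section Cases

theorem IsSection.add {e : ℤ} {f f' : ℂ[X]} (h : IsSection e f) (h' : IsSection e f') :
    IsSection e (f + f') := by
  obtain ⟨g, hg⟩ := h
  obtain ⟨g', hg'⟩ := h'
  exact ⟨g + g', by rw [map_add, map_add, map_add, hg, hg', mul_add]⟩

theorem isSection_C_mul_X_pow (a : ℂ) {i e : ℕ} (h : i ≤ e) :
    IsSection e (Polynomial.C a * Polynomial.X ^ i) := by
  refine ⟨Polynomial.C a * Polynomial.X ^ (e - i), ?_⟩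
  rw [Polynomial.toLaurent_C_mul_X_pow, Polynomial.toLaurent_C_mul_X_pow, map_mul,
    LaurentPolynomial.invert_C, LaurentPolynomial.invert_T, mul_left_comm,
    ← LaurentPolynomial.T_add]
  congr 2
  omega

/-- The symmetric matrix carrying the ray generators of `W_0` to the monomials of a generic
superpotential. -/
def symmZero : GL (Fin 3) ℤ where
  val := !![0, 0, 1; 0, 1, 0; 1, 0, 1]
  inv := !![-1, 0, 1; 0, 1, 0; 1, 0, 0]
  val_inv := by decide
  inv_val := by decide

/-- The symmetric matrix carrying the ray generators of `W_{-1}` to the monomials of a generic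
superpotential. -/
def symmNegOne : GL (Fin 3) ℤ where
  val := !![0, 1, 0; 1, 1, 0; 0, 0, 1]
  inv := !![-1, 1, 0; 1, 0, 0; 0, 0, 1]
  val_inv := by decide
  inv_val := by decide

theorem symmZero_transpose :
    (symmZero : Matrix (Fin 3) (Fin 3) ℤ)ᵀ = symmZero := by decide

theorem symmNegOne_transpose :
    (symmNegOne : Matrix (Fin 3) (Fin 3) ℤ)ᵀ = symmNegOne := by decide

/-- The ray relation `e₁ + (-1, 0, 2) = 2 e₃` becomes the relation `t₃ · t₁² t₃ = (t₁ t₃)²` of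
monomials, while `e₂` goes to `t₂`. -/
theorem symmZero_mulVec_rayMatrix (i : Fin 4) :
    (symmZero : Matrix (Fin 3) (Fin 3) ℤ) *ᵥ rayMatrix 0 i =
      (![![0, 0, 1], ![2, 0, 1], ![0, 1, 0], ![1, 0, 1]] : Fin 4 → Fin 3 → ℤ) i := by
  revert i
  decide

theorem exists_symmZero_mulVec_rayMatrix (m : Fin 3 → ℤ) :
    (∃ i, m = (symmZero : Matrix (Fin 3) (Fin 3) ℤ) *ᵥ rayMatrix 0 i) ↔
      m = ![0, 0, 1] ∨ m = ![2, 0, 1] ∨ m = ![0, 1, 0] ∨ m = ![1, 0, 1] := by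
  simp only [symmZero_mulVec_rayMatrix, Fin.exists_fin_succ, IsEmpty.exists_iff, or_false]
  rfl

/-- The conifold relation `e₁ + (-1, 1, 1) = e₂ + e₃` becomes `t₂ · t₁ t₃ = t₁ t₂ · t₃`. -/
theorem symmNegOne_mulVec_rayMatrix (i : Fin 4) :
    (symmNegOne : Matrix (Fin 3) (Fin 3) ℤ) *ᵥ rayMatrix (-1) i =
      (![![0, 1, 0], ![1, 0, 1], ![1, 1, 0], ![0, 0, 1]] : Fin 4 → Fin 3 → ℤ) i := by
  revert i
  decide

theorem exists_symmNegOne_mulVec_rayMatrix (m : Fin 3 → ℤ) :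
    (∃ i, m = (symmNegOne : Matrix (Fin 3) (Fin 3) ℤ) *ᵥ rayMatrix (-1) i) ↔
      m = ![0, 1, 0] ∨ m = ![1, 0, 1] ∨ m = ![1, 1, 0] ∨ m = ![0, 0, 1] := by
  simp only [symmNegOne_mulVec_rayMatrix, Fin.exists_fin_succ, IsEmpty.exists_iff, or_false]
  rfl

theorem coeff_superpotential_fst (f₁ f₂ : ℂ[X]) (i : ℕ) :
    (superpotential ![f₁, f₂]).coeff ![(i : ℤ), 1, 0] = f₁.coeff i := by
  rw [← Matrix.cons_val_zero f₁ ![f₂], ← coeff_superpotential]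
  congr 1
  ext l; fin_cases l <;> rfl

theorem coeff_superpotential_snd (f₁ f₂ : ℂ[X]) (i : ℕ) :
    (superpotential ![f₁, f₂]).coeff ![(i : ℤ), 0, 1] = f₂.coeff i := by
  change _ = (![f₁, f₂] 1).coeff i
  rw [← coeff_superpotential]
  congr 1
  ext l; fin_cases l <;> rfl

theorem mem_support_zero {f₁ f₂ : ℂ[X]} (h₁ : IsSection 0 f₁) (h₂ : IsSection 2 f₂)
    (ha : f₁.coeff 0 ≠ 0) (hb : ∀ i ≤ 2, f₂.coeff i ≠ 0) (m : Fin 3 → ℤ) :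
    m ∈ (superpotential ![f₁, f₂]).coeff.support ↔
      ∃ i, m = (symmZero : Matrix (Fin 3) (Fin 3) ℤ) *ᵥ rayMatrix 0 i := by
  rw [mem_support_superpotential_two, exists_symmZero_mulVec_rayMatrix]
  simp only [vec_three_eq_iff]
  constructor
  · rintro (⟨i, hi, h⟩ | ⟨i, hi, h⟩)
    · have : ¬ (0 < (i : ℤ)) := fun h => hi (h₁.coeff_eq_zero h)
      omega
    · have : ¬ (2 < (i : ℤ)) := fun h => hi (h₂.coeff_eq_zero h)
      omega
  · rintro (h | h | h | h)
    · exact Or.inr ⟨0, hb 0 (by norm_num), h⟩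
    · exact Or.inr ⟨2, hb 2 (by norm_num), h⟩
    · exact Or.inl ⟨0, ha, h⟩
    · exact Or.inr ⟨1, hb 1 (by norm_num), h⟩

theorem mem_support_negOne {f₁ f₂ : ℂ[X]} (h₁ : IsSection 1 f₁) (h₂ : IsSection 1 f₂)
    (ha : ∀ i ≤ 1, f₁.coeff i ≠ 0) (hb : ∀ i ≤ 1, f₂.coeff i ≠ 0) (m : Fin 3 → ℤ) :
    m ∈ (superpotential ![f₁, f₂]).coeff.support ↔
      ∃ i, m = (symmNegOne : Matrix (Fin 3) (Fin 3) ℤ) *ᵥ rayMatrix (-1) i := by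
  rw [mem_support_superpotential_two, exists_symmNegOne_mulVec_rayMatrix]
  simp only [vec_three_eq_iff]
  constructor
  · rintro (⟨i, hi, h⟩ | ⟨i, hi, h⟩)
    · have : ¬ (1 < (i : ℤ)) := fun h => hi (h₁.coeff_eq_zero h)
      omega
    · have : ¬ (1 < (i : ℤ)) := fun h => hi (h₂.coeff_eq_zero h)
      omega
  · rintro (h | h | h | h)
    · exact Or.inl ⟨0, ha 0 (by norm_num), h⟩
    · exact Or.inr ⟨1, hb 1 (by norm_num), h⟩
    · exact Or.inl ⟨1, ha 1 (by norm_num), h⟩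
    · exact Or.inr ⟨0, hb 0 (by norm_num), h⟩

theorem isMonMatrix_negOne {f₁ f₂ : ℂ[X]} (h₁ : IsSection 1 f₁) (h₂ : IsSection 1 f₂)
    (ha : ∀ i ≤ 1, f₁.coeff i ≠ 0) (hb : ∀ i ≤ 1, f₂.coeff i ≠ 0) :
    IsMonMatrix (superpotential ![f₁, f₂]) (rayMatrix (-1)) :=
  isMonMatrix_of_symm (rayMatrix_injective _) symmNegOne_transpose
    (mem_support_negOne h₁ h₂ ha hb)

/-- The bounds on `k` say that both degrees `k` and `-k - 2` are non-positive. Row `1` of `rayMatrix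
k` is the fibre over `z = ∞`, which carries the class. -/
theorem exists_isSelfDual_Wk {k : ℤ} (hk : -2 ≤ k) (hk' : k ≤ 0) {W : Laurent 3}
    {g : GL (Fin 3) ℤ} (hg : (g : Matrix (Fin 3) (Fin 3) ℤ)ᵀ = g)
    (hW : ∀ m, m ∈ W.coeff.support ↔
      ∃ i, m = (g : Matrix (Fin 3) (Fin 3) ℤ) *ᵥ rayMatrix k i)
    (hcoeff : ∀ i, W.coeff ((g : Matrix (Fin 3) (Fin 3) ℤ) *ᵥ rayMatrix k i) =
      if i = 1 then Complex.exp (2 * Real.pi * Complex.I * Complex.I) else 1)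
    (hreg : ∀ i j, 0 ≤ ((g : Matrix (Fin 3) (Fin 3) ℤ) *ᵥ rayMatrix k i) ⬝ᵥ rayMatrix k j) :
    ∃ S : Model 3, S.X = Wk k ∧ S.W = W ∧ S.IsSelfDual := by
  have hone : chartGen ![k, -k - 2] true 0 = rayMatrix k 1 := by
    ext l
    fin_cases l
    · rfl
    · rfl
    · change -(-k - 2) = k + 2
      ring
  have hray : ∀ b i, ∃ l, chartGen ![k, -k - 2] b i = rayMatrix k l := fun b i =>
    (exists_rayMatrix k _).2 ⟨b, i, rfl⟩
  refine exists_isSelfDual_totalSpace (fun j => ?_) hg (fun m => (hW m).trans ?_)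
    (fun b i => ?_) fun b i b' i' => ?_
  · fin_cases j
    · exact hk'
    · change -k - 2 ≤ 0
      omega
  · constructor
    · rintro ⟨l, rfl⟩
      obtain ⟨b, i, h⟩ := (exists_rayMatrix k _).1 ⟨l, rfl⟩
      exact ⟨b, i, by rw [h]⟩
    · rintro ⟨b, i, rfl⟩
      obtain ⟨l, h⟩ := hray b i
      exact ⟨l, by rw [h]⟩
  · obtain ⟨l, h⟩ := hray b i
    rw [h, hcoeff]
    refine if_congr ?_ rfl rfl
    rw [← chartGen_eq_iff ![k, -k - 2], h, hone, (rayMatrix_injective k).eq_iff]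
  · obtain ⟨l, h⟩ := hray b i
    obtain ⟨l', h'⟩ := hray b' i'
    rw [h, h']
    exact hreg l l'

/-- The coefficient of the superpotentials below for the ray generator with non-zero class. -/
noncomputable def kahlerCoeff : ℂ := Complex.exp (2 * Real.pi * Complex.I * Complex.I)

/-- The matrix of monomials is recorded as well, so that the same superpotential also proves the
claim on matrices. -/
theorem exists_isSelfDual_zero :
    ∃ S : Model 3, S.X = Wk 0 ∧ (∃ f₁ f₂ : ℂ[X], IsSection 0 f₁ ∧ IsSection 2 f₂ ∧
      S.W = superpotential ![f₁, f₂] ∧ IsMonMatrix S.W (rayMatrix 0)) ∧ S.IsSelfDual := by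
  set f₁ : ℂ[X] := Polynomial.C 1 * Polynomial.X ^ 0 with hf₁
  -- Row `1` of the ray matrix goes to `t₁² t₃`, so the special coefficient belongs to `z²`.
  set f₂ : ℂ[X] := Polynomial.C 1 * Polynomial.X ^ 0 + Polynomial.C 1 * Polynomial.X ^ 1 +
    Polynomial.C kahlerCoeff * Polynomial.X ^ 2 with hf₂
  have h₁ : IsSection 0 f₁ := isSection_C_mul_X_pow (e := 0) 1 le_rfl
  have h₂ : IsSection 2 f₂ := ((isSection_C_mul_X_pow (e := 2) _ (by norm_num)).add
    (isSection_C_mul_X_pow (e := 2) _ (by norm_num))).add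
    (isSection_C_mul_X_pow (e := 2) _ (by norm_num))
  have ha : f₁.coeff 0 = 1 := by simp [hf₁]
  have hb0 : f₂.coeff 0 = 1 := by simp [hf₂]
  have hb1 : f₂.coeff 1 = 1 := by simp [hf₂, Polynomial.coeff_X, Polynomial.coeff_one]
  have hb2 : f₂.coeff 2 = kahlerCoeff := by simp [hf₂, Polynomial.coeff_X, Polynomial.coeff_one]
  have hq : kahlerCoeff ≠ 0 := Complex.exp_ne_zero _
  have hsupp := mem_support_zero h₁ h₂ (by simp [ha]) fun i hi => by
    interval_cases i <;> simp [hb0, hb1, hb2, hq]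
  have hcoeff : ∀ i, (superpotential ![f₁, f₂]).coeff
      ((symmZero : Matrix (Fin 3) (Fin 3) ℤ) *ᵥ rayMatrix 0 i) =
        if i = 1 then kahlerCoeff else 1 := by
    intro i
    rw [symmZero_mulVec_rayMatrix]
    fin_cases i
    · exact (coeff_superpotential_snd f₁ f₂ 0).trans hb0
    · exact (coeff_superpotential_snd f₁ f₂ 2).trans hb2
    · exact (coeff_superpotential_fst f₁ f₂ 0).trans ha
    · exact (coeff_superpotential_snd f₁ f₂ 1).trans hb1
  obtain ⟨S, hX, hW, hS⟩ := exists_isSelfDual_Wk (k := 0) (by norm_num) le_rfl symmZero_transpose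
    hsupp hcoeff (by decide)
  exact ⟨S, hX, ⟨f₁, f₂, h₁, h₂, hW, hW ▸ isMonMatrix_of_symm (rayMatrix_injective _)
      symmZero_transpose hsupp⟩, hS⟩

theorem exists_isSelfDual_negOne :
    ∃ S : Model 3, S.X = Wk (-1) ∧ (∃ f₁ f₂ : ℂ[X], IsSection 1 f₁ ∧ IsSection 1 f₂ ∧
      S.W = superpotential ![f₁, f₂] ∧ IsMonMatrix S.W (rayMatrix (-1))) ∧ S.IsSelfDual := by
  set f₁ : ℂ[X] := Polynomial.C 1 * Polynomial.X ^ 0 + Polynomial.C 1 * Polynomial.X ^ 1 with hf₁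
  -- Here row `1` goes to `t₁ t₃`, so the special coefficient belongs to `z` in `f₂`.
  set f₂ : ℂ[X] := Polynomial.C 1 * Polynomial.X ^ 0 +
    Polynomial.C kahlerCoeff * Polynomial.X ^ 1 with hf₂
  have hsec : ∀ a b : ℂ, IsSection 1 (Polynomial.C a * Polynomial.X ^ 0 +
      Polynomial.C b * Polynomial.X ^ 1) := fun a b =>
    (isSection_C_mul_X_pow (e := 1) _ (by norm_num)).add
      (isSection_C_mul_X_pow (e := 1) _ (by norm_num))
  have ha0 : f₁.coeff 0 = 1 := by simp [hf₁]
  have ha1 : f₁.coeff 1 = 1 := by simp [hf₁, Polynomial.coeff_one]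
  have hb0 : f₂.coeff 0 = 1 := by simp [hf₂]
  have hb1 : f₂.coeff 1 = kahlerCoeff := by simp [hf₂, Polynomial.coeff_one]
  have hq : kahlerCoeff ≠ 0 := Complex.exp_ne_zero _
  have hf₁0 : ∀ i ≤ 1, f₁.coeff i ≠ 0 := fun i hi => by
    interval_cases i <;> simp [ha0, ha1]
  have hf₂0 : ∀ i ≤ 1, f₂.coeff i ≠ 0 := fun i hi => by
    interval_cases i <;> simp [hb0, hb1, hq]
  have hcoeff : ∀ i, (superpotential ![f₁, f₂]).coeff
      ((symmNegOne : Matrix (Fin 3) (Fin 3) ℤ) *ᵥ rayMatrix (-1) i) =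
        if i = 1 then kahlerCoeff else 1 := by
    intro i
    rw [symmNegOne_mulVec_rayMatrix]
    fin_cases i
    · exact (coeff_superpotential_fst f₁ f₂ 0).trans ha0
    · exact (coeff_superpotential_snd f₁ f₂ 1).trans hb1
    · exact (coeff_superpotential_fst f₁ f₂ 1).trans ha1
    · exact (coeff_superpotential_snd f₁ f₂ 0).trans hb0
  obtain ⟨S, hX, hW, hS⟩ := exists_isSelfDual_Wk (k := -1) (by norm_num) (by norm_num)
    symmNegOne_transpose (mem_support_negOne (hsec _ _) (hsec _ _) hf₁0 hf₂0) hcoeff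
    (by decide)
  exact ⟨S, hX, ⟨f₁, f₂, hsec _ _, hsec _ _, hW,
      hW ▸ isMonMatrix_negOne (hsec _ _) (hsec _ _) hf₁0 hf₂0⟩, hS⟩

/-! ## The remaining cases -/

/-- As `f₁` has negative degree it vanishes, and only the monomials of `t₃ f₂` remain. -/
theorem mon_superpotential_eq_zero {k : ℤ} (hk : 1 ≤ k) {f₁ f₂ : ℂ[X]} (h₁ : IsSection (-k) f₁) :
    mon (superpotential ![f₁, f₂]) (Pi.single 1 1) = 0 := by
  ext ξ
  change ξ.1 ⬝ᵥ _ = 0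
  rw [dotProduct_single_one]
  rcases (mem_support_superpotential_two f₁ f₂ ξ.1).1 ξ.2 with ⟨i, hi, _⟩ | ⟨i, -, -, h, -⟩
  · exact absurd (h₁.coeff_eq_zero (by omega)) hi
  · exact h

/-- The generators of a single chart already form a basis of `N`. -/
theorem dv_totalSpace_injective {c : ℕ} (d : Fin c → ℤ) :
    Function.Injective (dv (totalSpace d).cones) := by
  rw [injective_iff_map_eq_zero]
  refine fun m hm => eq_zero_of_dotProduct_chartGen (d := d) fun b i => ?_
  exact congrFun hm ⟨_, (isDivisor_totalSpace_iff d _).2 ⟨b, i, rfl⟩⟩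

theorem dv_map_injective {n : ℕ} {cones : Set (PointedCone ℝ (Fin n → ℝ))} (g : GL (Fin n) ℤ)
    (h : Function.Injective (dv cones)) :
    Function.Injective (dv (PointedCone.map (realMap g) '' cones)) := by
  rw [injective_iff_map_eq_zero] at h ⊢
  intro m hm
  have h1 : m ᵥ* (g : Matrix (Fin n) (Fin n) ℤ) = 0 := h _ <| by
    ext D
    change _ ⬝ᵥ D.1 = 0
    rw [← Matrix.dotProduct_mulVec]
    exact congrFun hm ⟨_, IsDivisor.mulVec g D.2⟩
  have h2 := congrArg (fun v => v ᵥ* ((g⁻¹ : GL (Fin n) ℤ) : Matrix (Fin n) (Fin n) ℤ)) h1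
  simpa [Matrix.vecMul_vecMul] using h2

/-- For a self-dual model on a variety without torus factors, `mon` is injective. -/
theorem Model.IsSelfDual.mon_injective {n : ℕ} {S : Model n} (hS : S.IsSelfDual)
    (h : Function.Injective (dv S.X.cones)) : Function.Injective (mon S.W) := by
  obtain ⟨S', ⟨L, -, -, -, -, r, hr, -⟩, g, -, hX, -⟩ := hS
  have h' : Function.Injective (dv S'.X.cones) := by
    rw [hX]
    exact dv_map_injective g h
  -- The reduction of the exchanged data writes the `dv` of the dual as `r ∘ mon`.
  rw [← hr.2.2] at h'
  exact Function.Injective.of_comp (f := r) h'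

/-- Injectivity means linear independence of the columns, and the two maps share their matrix. -/
theorem mon_injective_of_matrix {n m : ℕ} {ι : Type} {X : ToricVariety n} {W : Laurent n}
    {D : Matrix ι (Fin m) ℤ} (hD : IsDvMatrix X D) (hE : IsMonMatrix W D)
    (h : Function.Injective (dv X.cones)) : Function.Injective (mon W) := by
  obtain ⟨b, e, hb⟩ := hD
  obtain ⟨b', e', hb'⟩ := hE
  rw [injective_iff_map_eq_zero] at h ⊢
  intro ν hν
  have hsum : ∀ i, ∑ j, b'.repr ν j * D i j = 0 := by
    intro i
    have := congrFun hν (e' i)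
    rw [← b'.sum_repr ν, map_sum, Finset.sum_apply] at this
    simpa only [map_smul, Pi.smul_apply, smul_eq_mul, ← hb', Pi.zero_apply] using this
  -- The coordinates of `ν` in the basis of `N` are reused as coordinates of a character, which `dv`
  -- then kills.
  have h0 : ∑ j, b'.repr ν j • b j = 0 := h _ <| by
    ext R
    obtain ⟨i, rfl⟩ := e.surjective R
    rw [map_sum, Finset.sum_apply]
    simpa only [map_smul, Pi.smul_apply, smul_eq_mul, ← hb, Pi.zero_apply] using hsum i
  have hrepr := Fintype.linearIndependent_iff.1 b.linearIndependent _ h0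
  rw [← b'.sum_repr ν]
  simp [hrepr]

end Cases

end ToricLG

/-! ### The proposition on `W_k` -/

theorem mainTheorem3 :
    -- `W_k` belongs to a self-dual model, with superpotential from a section of `𝒪(-k) ⊕ 𝒪(k+2)`,
    -- if and only if `k = 0` or `k = -1`
    (∀ k : ℤ, -1 ≤ k →
      ((∃ S : ToricLG.Model 3, S.X = ToricLG.Wk k ∧
          (∃ f₁ f₂ : Polynomial ℂ, ToricLG.IsSection (-k) f₁ ∧ ToricLG.IsSection (k + 2) f₂ ∧
            S.W = ToricLG.superpotential ![f₁, f₂]) ∧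
          S.IsSelfDual) ↔ k = 0 ∨ k = -1)) ∧
    -- the same dichotomy for the matrices: `M_dv = M_mon` in suitable bases and orderings
    (∀ k : ℤ, -1 ≤ k →
      ((∃ (f₁ f₂ : Polynomial ℂ) (D : Matrix (Fin 4) (Fin 3) ℤ),
          ToricLG.IsSection (-k) f₁ ∧ ToricLG.IsSection (k + 2) f₂ ∧
          ToricLG.IsDvMatrix (ToricLG.Wk k) D ∧
          ToricLG.IsMonMatrix (ToricLG.superpotential ![f₁, f₂]) D) ↔ k = 0 ∨ k = -1)) ∧
    -- for `k = 0` the matrices are those of `Tot(𝒪(-2))` plus an identity block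
    (∀ (ι : Type) (D : Matrix ι (Fin 2) ℤ),
      ToricLG.IsDvMatrix (ToricLG.totalSpace ![-2]) D →
      ToricLG.IsDvMatrix (ToricLG.Wk 0) (Matrix.fromBlocks D 0 0 (1 : Matrix Unit Unit ℤ))) ∧
    (∀ f₁ f₂ : Polynomial ℂ, ToricLG.IsSection 0 f₁ → ToricLG.IsSection 2 f₂ → f₁ ≠ 0 →
      ∀ (ι : Type) (E : Matrix ι (Fin 2) ℤ),
        ToricLG.IsMonMatrix (ToricLG.superpotential ![f₂]) E →
        ToricLG.IsMonMatrix (ToricLG.superpotential ![f₁, f₂])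
          (Matrix.fromBlocks E 0 0 (1 : Matrix Unit Unit ℤ))) ∧
    -- for `k = -1` and a generic section, an explicit common matrix
    (ToricLG.IsDvMatrix (ToricLG.Wk (-1)) !![1, 0, 0; -1, 1, 1; 0, 1, 0; 0, 0, 1] ∧
      ∀ f₁ f₂ : Polynomial ℂ, ToricLG.IsSection 1 f₁ → ToricLG.IsSection 1 f₂ →
        f₁.coeff 0 ≠ 0 → f₁.coeff 1 ≠ 0 → f₂.coeff 0 ≠ 0 → f₂.coeff 1 ≠ 0 →
        ToricLG.IsMonMatrix (ToricLG.superpotential ![f₁, f₂])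
          !![1, 0, 0; -1, 1, 1; 0, 1, 0; 0, 0, 1]) := by
  -- Both "only if" directions pass through injectivity of `mon`, which excludes `k ≥ 1`.
  have hle : ∀ {k : ℤ} {f₁ f₂ : ℂ[X]}, -1 ≤ k → ToricLG.IsSection (-k) f₁ →
      Function.Injective (ToricLG.mon (ToricLG.superpotential ![f₁, f₂])) → k = 0 ∨ k = -1 := by
    intro k f₁ f₂ hk h₁ hinj
    by_contra hc
    have h0 := hinj ((ToricLG.mon_superpotential_eq_zero (f₂ := f₂) (by omega) h₁).trans
      (map_zero _).symm)
    exact one_ne_zero (Pi.single_eq_zero_iff.1 h0)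
  refine ⟨fun k hk => ⟨?_, ?_⟩, fun k hk => ⟨?_, ?_⟩,
    fun ι D hD => ToricLG.isDvMatrix_fromBlocks hD,
    fun f₁ f₂ h₁ _ h0 ι E hE => ToricLG.isMonMatrix_fromBlocks h₁ h0 hE,
    ToricLG.isDvMatrix_rayMatrix (-1), fun f₁ f₂ h₁ h₂ ha0 ha1 hb0 hb1 =>
      ToricLG.isMonMatrix_negOne h₁ h₂ (fun i hi => by interval_cases i <;> assumption)
        fun i hi => by interval_cases i <;> assumption⟩
  · rintro ⟨S, hX, ⟨f₁, f₂, h₁, -, hW⟩, hS⟩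
    refine hle hk h₁ (hW ▸ hS.mon_injective ?_)
    rw [hX]
    exact ToricLG.dv_totalSpace_injective _
  · rintro (rfl | rfl)
    · obtain ⟨S, hX, ⟨f₁, f₂, h₁, h₂, hW, -⟩, hS⟩ := ToricLG.exists_isSelfDual_zero
      exact ⟨S, hX, ⟨f₁, f₂, h₁, h₂, hW⟩, hS⟩
    · obtain ⟨S, hX, ⟨f₁, f₂, h₁, h₂, hW, -⟩, hS⟩ := ToricLG.exists_isSelfDual_negOne
      exact ⟨S, hX, ⟨f₁, f₂, h₁, h₂, hW⟩, hS⟩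
  · rintro ⟨f₁, f₂, D, h₁, -, hD, hE⟩
    exact hle hk h₁ (ToricLG.mon_injective_of_matrix hD hE (ToricLG.dv_totalSpace_injective _))
  · rintro (rfl | rfl)
    · obtain ⟨S, -, ⟨f₁, f₂, h₁, h₂, hW, hE⟩, -⟩ := ToricLG.exists_isSelfDual_zero
      exact ⟨f₁, f₂, _, h₁, h₂, ToricLG.isDvMatrix_rayMatrix 0, hW ▸ hE⟩
    · obtain ⟨S, -, ⟨f₁, f₂, h₁, h₂, hW, hE⟩, -⟩ := ToricLG.exists_isSelfDual_negOne
      exact ⟨f₁, f₂, _, h₁, h₂, ToricLG.isDvMatrix_rayMatrix (-1), hW ▸ hE⟩
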